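/- Let $d \ge 3$ be an integer. For $0<\delta\le 1$, $a\in\mathbb{R}^d$ and $\xi\in S^{d-1}$, let $$T_\xi^\delta(a)=\left\{y\in\mathbb{R}^d : |(y-a)\cdot\xi|\le \tfrac12,\ \left|(y-a)-((y-a)\cdot\xi)\,\xi\right|\le\delta\right\}$$ be the tube of length $1$ and cross-sectional radius $\delta$ centred at $a$ with direction $\xi$, and for $f\in L^{(d+2)/2}(\mathbb{R}^d)$ let $$f_\delta^*(\xi)=\sup_{a\in\mathbb{R}^d}\frac{1}{|T_\xi^\delta(a)|}\int_{T_\xi^\delta(a)}|f(y)|\,dy,\qquad \xi\in S^{d-1},$$ be the Kakeya maximal function of $f$. Then for every $\varepsilon>0$ there is a constant $C_\varepsilon>0$, depending only on $d$ and $\varepsilon$, such that for all $0<\delta\le1$ and all complex-valued $f\in L^{(d+2)/2}(\mathbb{R}^d)$ the function $f_\delta^*$ is measurable and $$\|f_\delta^*\|_{L^{(d-1)(d+2)/d}(S^{d-1})}\le C_\varepsilon\,\delta^{\,1-\frac{2d}{d+2}-\varepsilon}\,\|f\|_{L^{(d+2)/2}(\mathbb{R}^d)},$$ where $S^{d-1}$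 carries its surface measure and $\mathbb{R}^d$ Lebesgue measure. -/

import Mathlib

open MeasureTheory
open scoped ENNReal

/-- The `1 × δ × ⋯ × δ` tube with centre `a` and direction `ξ`: the points whose displacement from
`a` has component along the unit vector `ξ` of size at most `1 / 2` and component orthogonal to `ξ`
of norm at most `δ`. -/
def kakeyaTube {d : ℕ} (δ : ℝ) (ξ a : EuclideanSpace ℝ (Fin d)) :
    Set (EuclideanSpace ℝ (Fin d)) :=
  {y | |inner ℝ (y - a) ξ| ≤ 1 / 2 ∧ ‖(y - a) - inner ℝ (y - a) ξ • ξ‖ ≤ δ}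

/-- The Kakeya maximal function of `f` at scale `δ`, with values in `[0, ∞]`. -/
noncomputable def kakeyaMaximal {d : ℕ} (δ : ℝ) (f : EuclideanSpace ℝ (Fin d) → ℂ)
    (ξ : Metric.sphere (0 : EuclideanSpace ℝ (Fin d)) 1) : ℝ≥0∞ :=
  ⨆ a : EuclideanSpace ℝ (Fin d),
    (volume (kakeyaTube δ (ξ : EuclideanSpace ℝ (Fin d)) a))⁻¹ *
      ∫⁻ y in kakeyaTube δ (ξ : EuclideanSpace ℝ (Fin d)) a, ‖f y‖ₑ

/-!
Wolff's bound for the Kakeya maximal function, by the hairbrush argument.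

By duality, the maximal function estimate is a bound for the `L ^ ((d + 2) / d)` norm of the
counting function `∑ u ∈ Ω, 1_{T u}` of a family of `N` tubes with `δ`-separated directions, namely
`∫ (∑ 1_{T u}) ^ ((d + 2) / d) ≲ δ ^ (d - 1) * N ^ ((d ^ 2 - 2) / (d * (d - 1)))`
(`exists_norm_const`). Powers of the number `K ≈ log (1 / δ)` of dyadic scales are harmless, as they
are absorbed into `δ ^ (-ε)` at the end, and every quantity may be localized dyadically.

Let `E` be the set where the multiplicity is about `μ`. Among the `μ ^ 2` pairs of tubes through a
point of `E`, a proportion makes an angle about `θ` for one dyadic `θ`, and lies in one of boundedly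
overlapping caps of radius about `θ` (`exists_le_pairCount`). Since the exponent of `N` is at least
`1`, it is enough to treat each cap on its own. There, after the tubes with small density in `E` are
discarded, some tube is met by many others at angle about `θ`: it is the stem of a hairbrush. As two
tubes at angle `θ` share a volume of at most `δ ^ d / θ`, the number of bristles is at least
`|E| * μ ^ 2 * θ / (N * δ ^ d)`.

Conversely, bristles with density `l` in `E` force `|E| ≳ l ^ d * δ ^ (d - 1) * #bristles`
(`exists_hairbrush_const`). Indeed two bristles which meet at distance at least `l` from the stem,
measured along a bristle, and the stem itself are coplanar up to an angle `δ / l`, so that Córdoba's `L ^ 2` argument for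
planar families applies with a loss of `l ^ (2 - d)`; removing the part of each bristle near the
stem costs only half of its density. With `l ≈ |E| * μ / (N * δ ^ (d - 1))` and
`N ≲ (θ / δ) ^ (d - 1)`, comparing the two bounds gives the estimate for `|E|`
(`exists_pair_const`, `exists_cap_const`).

The directions of a tube and of its reverse are different unit vectors, so that all families of
directions are first restricted to pieces of the sphere of diameter at most `1 / 4`, on which
distances and angles are comparable.
-/

/-! ### Vectors orthogonal to a direction, cylinders and boxes -/

section Geometry

variable {d : ℕ}

/-- The component of a vector orthogonal to the (unit) vector `ω`. -/
noncomputable def perp (ω : EuclideanSpace ℝ (Fin d)) :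
    EuclideanSpace ℝ (Fin d) →L[ℝ] EuclideanSpace ℝ (Fin d) :=
  ContinuousLinearMap.id ℝ _ - (innerSL ℝ ω).smulRight ω

lemma perp_apply (ω v : EuclideanSpace ℝ (Fin d)) :
    perp ω v = v - inner ℝ v ω • ω := by
  simp [perp, real_inner_comm]

lemma perp_smul_self {ω : EuclideanSpace ℝ (Fin d)} (hω : ‖ω‖ = 1) (c : ℝ) :
    perp ω (c • ω) = 0 := by
  rw [perp_apply, real_inner_smul_left, real_inner_self_eq_norm_sq, hω]; simp

lemma norm_sq_eq_inner_sq_add_perp {ω : EuclideanSpace ℝ (Fin d)} (hω : ‖ω‖ = 1)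
    (v : EuclideanSpace ℝ (Fin d)) : ‖v‖ ^ 2 = (inner ℝ v ω) ^ 2 + ‖perp ω v‖ ^ 2 := by
  rw [perp_apply, norm_sub_sq_real, inner_smul_right, norm_smul, hω, Real.norm_eq_abs, mul_one,
    sq_abs]
  ring

lemma norm_perp_le {ω : EuclideanSpace ℝ (Fin d)} (hω : ‖ω‖ = 1)
    (v : EuclideanSpace ℝ (Fin d)) : ‖perp ω v‖ ≤ ‖v‖ := by
  have := norm_sq_eq_inner_sq_add_perp hω v
  exact le_of_sq_le_sq (by nlinarith [sq_nonneg (inner ℝ v ω)]) (norm_nonneg _)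

/-- Two unit vectors near a unit vector `e` differ mostly orthogonally to `e`: their difference is
orthogonal to their sum, which is nearly parallel to `e`. -/
lemma norm_sub_le_two_mul_norm_perp {e u v : EuclideanSpace ℝ (Fin d)} (he : ‖e‖ = 1)
    (hu : ‖u‖ = 1) (hv : ‖v‖ = 1) (hue : ‖u - e‖ ≤ 1 / 4) (hve : ‖v - e‖ ≤ 1 / 4) :
    ‖u - v‖ ≤ 2 * ‖perp e (u - v)‖ := by
  have h1 : inner ℝ (u - v) (u + v) = 0 := by
    rw [inner_sub_left, inner_add_right, inner_add_right, real_inner_self_eq_norm_sq,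
      real_inner_self_eq_norm_sq, hu, hv, real_inner_comm]; ring
  have h2 : inner ℝ (u - v) e = - (inner ℝ (u - v) ((u - e) + (v - e))) / 2 := by
    have : (u - e) + (v - e) = (u + v) - (2 : ℝ) • e := by rw [two_smul]; abel
    rw [this, inner_sub_right, h1, inner_smul_right]; ring
  have h3 : |inner ℝ (u - v) ((u - e) + (v - e))| ≤ ‖u - v‖ * (1 / 2) := by
    refine (abs_real_inner_le_norm _ _).trans ?_
    gcongr
    exact (norm_add_le _ _).trans (by linarith)
  have h4 : |inner ℝ (u - v) e| ≤ ‖u - v‖ / 4 := by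
    rw [h2, neg_div, abs_neg, abs_div, abs_two]; linarith
  have h5 := norm_sq_eq_inner_sq_add_perp he (u - v)
  have h6 : (inner ℝ (u - v) e) ^ 2 ≤ (‖u - v‖ / 4) ^ 2 := sq_le_sq' (by
    linarith [neg_abs_le (inner ℝ (u - v) e)]) ((le_abs_self _).trans h4)
  refine le_of_sq_le_sq ?_ (by positivity)
  nlinarith [sq_nonneg ‖u - v‖]

/-- The solid cylinder with centre `z`, axis direction `ω`, half-length `s` and radius `r`. -/
def solidCylinder (s r : ℝ) (ω z : EuclideanSpace ℝ (Fin d)) : Set (EuclideanSpace ℝ (Fin d)) :=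
  {y | |inner ℝ (y - z) ω| ≤ s ∧ ‖perp ω (y - z)‖ ≤ r}

lemma kakeyaTube_eq_solidCylinder (δ : ℝ) (ω a : EuclideanSpace ℝ (Fin d)) :
    kakeyaTube δ ω a = solidCylinder (1 / 2) δ ω a := by
  ext y; simp only [kakeyaTube, solidCylinder, perp_apply, Set.mem_ofPred_eq]

lemma isClosed_solidCylinder (s r : ℝ) (ω z : EuclideanSpace ℝ (Fin d)) :
    IsClosed (solidCylinder s r ω z) := by
  have h1 : IsClosed {y | |inner ℝ (y - z) ω| ≤ s} := isClosed_le (by fun_prop) continuous_const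
  have h2 : IsClosed {y | ‖perp ω (y - z)‖ ≤ r} := isClosed_le (by fun_prop) continuous_const
  exact h1.inter h2

lemma measurableSet_kakeyaTube (δ : ℝ) (ω a : EuclideanSpace ℝ (Fin d)) :
    MeasurableSet (kakeyaTube δ ω a) := by
  rw [kakeyaTube_eq_solidCylinder]; exact (isClosed_solidCylinder _ _ _ _).measurableSet

lemma volume_orthonormal_box (b : OrthonormalBasis (Fin d) ℝ (EuclideanSpace ℝ (Fin d)))
    (z : EuclideanSpace ℝ (Fin d)) {r : Fin d → ℝ} (hr : ∀ i, 0 ≤ r i) :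
    volume {y | ∀ i, |inner ℝ (b i) (y - z)| ≤ r i} = ENNReal.ofReal (∏ i, (2 * r i)) := by
  have hset : {y | ∀ i, |inner ℝ (b i) (y - z)| ≤ r i} =
      b.repr ⁻¹' ((WithLp.ofLp) ⁻¹' (Set.Icc (fun i => b.repr z i - r i)
        (fun i => b.repr z i + r i))) := by
    ext y
    simp only [Set.mem_ofPred_eq, Set.mem_preimage, Set.mem_Icc, Pi.le_def, ← forall_and]
    refine forall_congr' fun i => ?_
    rw [inner_sub_right, ← b.repr_apply_apply, ← b.repr_apply_apply, abs_le]
    constructor <;> rintro ⟨h1, h2⟩ <;> constructor <;> linarith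
  rw [hset, b.measurePreserving_repr.measure_preimage_emb
      b.repr.toHomeomorph.measurableEmbedding,
    (PiLp.volume_preserving_ofLp (Fin d)).measure_preimage measurableSet_Icc.nullMeasurableSet,
    Real.volume_Icc_pi, ENNReal.ofReal_prod_of_nonneg (fun i _ => by linarith [hr i])]
  refine Finset.prod_congr rfl fun i _ => ?_
  congr 1; ring

lemma exists_orthonormalBasis_apply_eq (i₀ : Fin d) {e : EuclideanSpace ℝ (Fin d)}
    (he : ‖e‖ = 1) :
    ∃ b : OrthonormalBasis (Fin d) ℝ (EuclideanSpace ℝ (Fin d)), b i₀ = e := by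
  have h : Orthonormal ℝ (Set.domRestrict {i₀} fun _ : Fin d => e) := by
    refine ⟨fun i => he, fun i j hij => (hij (Subsingleton.elim i j)).elim⟩
  obtain ⟨b, hb⟩ := h.exists_orthonormalBasis_extension_of_card_eq (by simp)
  exact ⟨b, hb i₀ rfl⟩

lemma exists_orthonormalBasis_apply_eq₂ {i₀ i₁ : Fin d} (hi : i₀ ≠ i₁)
    {e f : EuclideanSpace ℝ (Fin d)} (he : ‖e‖ = 1) (hf : ‖f‖ = 1) (hef : inner ℝ e f = 0) :
    ∃ b : OrthonormalBasis (Fin d) ℝ (EuclideanSpace ℝ (Fin d)), b i₀ = e ∧ b i₁ = f := by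
  have h : Orthonormal ℝ
      (Set.domRestrict {i₀, i₁} fun i : Fin d => if i = i₀ then e else f) := by
    have hfe : inner ℝ f e = 0 := by rw [real_inner_comm]; exact hef
    refine ⟨fun ⟨i, _⟩ => ?_, fun ⟨i, hi'⟩ ⟨j, hj'⟩ hij => ?_⟩
    · change ‖if i = i₀ then e else f‖ = 1
      split_ifs <;> assumption
    · change inner ℝ (if i = i₀ then e else f) (if j = i₀ then e else f) = 0
      have hij' : i ≠ j := fun h => hij (Subtype.ext h)
      simp only [Set.mem_insert_iff, Set.mem_singleton_iff] at hi' hj'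
      split_ifs with h1 h2 h2
      · exact absurd (h1.trans h2.symm) hij'
      · exact hef
      · exact hfe
      · exact absurd ((hi'.resolve_left h1).trans (hj'.resolve_left h2).symm) hij'
  obtain ⟨b, hb⟩ := h.exists_orthonormalBasis_extension_of_card_eq (by simp)
  refine ⟨b, ?_, ?_⟩
  · simpa using hb i₀ (by simp)
  · simpa [hi.symm] using hb i₁ (by simp)

lemma inner_eq_inner_perp {ω v w : EuclideanSpace ℝ (Fin d)} (h : inner ℝ w ω = 0) :
    inner ℝ w v = inner ℝ w (perp ω v) := by
  rw [perp_apply, inner_sub_right, inner_smul_right, h]; simp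

lemma OrthonormalBasis.inner_perp_eq (b : OrthonormalBasis (Fin d) ℝ (EuclideanSpace ℝ (Fin d)))
    {i j : Fin d} (h : j ≠ i) (v : EuclideanSpace ℝ (Fin d)) :
    inner ℝ (b j) (perp (b i) v) = inner ℝ (b j) v :=
  (inner_eq_inner_perp (b.orthonormal.2 h)).symm

lemma prod_ite_eq_mul_pow (i₀ : Fin d) (s r : ℝ) :
    ∏ i, (if i = i₀ then s else r) = s * r ^ (d - 1) := by
  rw [← Finset.mul_prod_erase _ _ (Finset.mem_univ i₀), if_pos rfl]
  congr 1
  rw [Finset.prod_congr rfl (g := fun _ => r) (fun i hi => if_neg (Finset.ne_of_mem_erase hi))]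
  simp

lemma volume_solidCylinder_le (hd : 0 < d) {s r : ℝ} (hs : 0 ≤ s) (hr : 0 ≤ r)
    {ω : EuclideanSpace ℝ (Fin d)} (hω : ‖ω‖ = 1) (z : EuclideanSpace ℝ (Fin d)) :
    volume (solidCylinder s r ω z) ≤ ENNReal.ofReal (2 ^ d * s * r ^ (d - 1)) := by
  obtain ⟨b, hb⟩ := exists_orthonormalBasis_apply_eq ⟨0, hd⟩ hω
  have hsub : solidCylinder s r ω z ⊆
      {y | ∀ i, |inner ℝ (b i) (y - z)| ≤ if i = ⟨0, hd⟩ then s else r} := by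
    rintro y ⟨h1, h2⟩ i
    split_ifs with h
    · rw [h, hb, real_inner_comm]; exact h1
    · rw [← b.inner_perp_eq h, hb]
      refine (abs_real_inner_le_norm _ _).trans ?_
      rw [b.orthonormal.1 i, one_mul]; exact h2
  refine (measure_mono hsub).trans ?_
  rw [volume_orthonormal_box b z (fun i => by split_ifs <;> assumption)]
  refine le_of_eq ?_
  rw [Finset.prod_mul_distrib, prod_ite_eq_mul_pow]
  simp [mul_assoc]

lemma le_volume_solidCylinder (hd : 0 < d) {s r : ℝ} (hs : 0 ≤ s) (hr : 0 ≤ r)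
    {ω : EuclideanSpace ℝ (Fin d)} (hω : ‖ω‖ = 1) (z : EuclideanSpace ℝ (Fin d)) :
    ENNReal.ofReal (2 ^ d * s * (r / d) ^ (d - 1)) ≤ volume (solidCylinder s r ω z) := by
  obtain ⟨b, hb⟩ := exists_orthonormalBasis_apply_eq ⟨0, hd⟩ hω
  have hd' : (0 : ℝ) < d := by exact_mod_cast hd
  have hsub : {y | ∀ i, |inner ℝ (b i) (y - z)| ≤ if i = ⟨0, hd⟩ then s else r / d} ⊆
      solidCylinder s r ω z := by
    intro y hy
    refine ⟨by simpa [hb, real_inner_comm] using hy ⟨0, hd⟩, ?_⟩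
    have hle : ∀ i, |inner ℝ (b i) (perp ω (y - z))| ≤ r / d := by
      intro i
      by_cases h : i = ⟨0, hd⟩
      · have : inner ℝ (b i) (perp ω (y - z)) = 0 := by
          rw [h, hb, perp_apply, inner_sub_right, inner_smul_right, real_inner_self_eq_norm_sq,
            hω, real_inner_comm]; ring
        rw [this, abs_zero]; positivity
      · have := hy i
        rw [if_neg h] at this
        rwa [← hb, b.inner_perp_eq h]
    rw [← b.sum_repr' (perp ω (y - z))]
    refine (norm_sum_le _ _).trans ?_
    calc ∑ i, ‖inner ℝ (b i) (perp ω (y - z)) • b i‖ ≤ ∑ _i : Fin d, r / d := by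
          refine Finset.sum_le_sum fun i _ => ?_
          rw [norm_smul, b.orthonormal.1 i, mul_one]; exact hle i
      _ = r := by rw [Finset.sum_const]; simp; field_simp
  refine le_trans ?_ (measure_mono hsub)
  rw [volume_orthonormal_box b z (fun i => by split_ifs <;> positivity)]
  refine le_of_eq ?_
  rw [Finset.prod_mul_distrib, prod_ite_eq_mul_pow]
  simp [mul_assoc]

end Geometry

/-! ### Tubes: volumes, intersections and counting of directions -/

section Geometry

variable {d : ℕ}

lemma norm_perp_sub_le_of_mem_kakeyaTube {δ : ℝ} {ω a x y : EuclideanSpace ℝ (Fin d)}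
    (hx : x ∈ kakeyaTube δ ω a) (hy : y ∈ kakeyaTube δ ω a) : ‖perp ω (x - y)‖ ≤ 2 * δ := by
  rw [kakeyaTube_eq_solidCylinder] at hx hy
  have : perp ω (x - y) = perp ω (x - a) - perp ω (y - a) := by rw [← map_sub]; congr 1; abel
  rw [this]
  exact (norm_sub_le _ _).trans (by linarith [hx.2, hy.2])

lemma inner_smul_add_perp (ω v : EuclideanSpace ℝ (Fin d)) :
    inner ℝ v ω • ω + perp ω v = v := by
  rw [perp_apply]; abel

lemma volume_kakeyaTube_le (hd : 0 < d) {δ : ℝ} (hδ : 0 < δ) {ω : EuclideanSpace ℝ (Fin d)}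
    (hω : ‖ω‖ = 1) (a : EuclideanSpace ℝ (Fin d)) :
    volume (kakeyaTube δ ω a) ≤ ENNReal.ofReal (2 ^ d * δ ^ (d - 1)) := by
  rw [kakeyaTube_eq_solidCylinder]
  refine (volume_solidCylinder_le hd (by norm_num) hδ.le hω a).trans
    (ENNReal.ofReal_le_ofReal ?_)
  have : 0 ≤ 2 ^ d * δ ^ (d - 1) := by positivity
  linarith

lemma volume_kakeyaTube_ne_top (hd : 0 < d) {δ : ℝ} (hδ : 0 < δ)
    {ω : EuclideanSpace ℝ (Fin d)} (hω : ‖ω‖ = 1) (a : EuclideanSpace ℝ (Fin d)) :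
    volume (kakeyaTube δ ω a) ≠ ∞ :=
  ((volume_kakeyaTube_le hd hδ hω a).trans_lt ENNReal.ofReal_lt_top).ne

lemma volume_real_kakeyaTube_le (hd : 0 < d) {δ : ℝ} (hδ : 0 < δ)
    {ω : EuclideanSpace ℝ (Fin d)} (hω : ‖ω‖ = 1) (a : EuclideanSpace ℝ (Fin d)) :
    volume.real (kakeyaTube δ ω a) ≤ 2 ^ d * δ ^ (d - 1) :=
  ENNReal.toReal_le_of_le_ofReal (by positivity) (volume_kakeyaTube_le hd hδ hω a)

lemma le_volume_real_kakeyaTube (hd : 0 < d) {δ : ℝ} (hδ : 0 < δ)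
    {ω : EuclideanSpace ℝ (Fin d)} (hω : ‖ω‖ = 1) (a : EuclideanSpace ℝ (Fin d)) :
    2 ^ d * (1 / 2) * (δ / d) ^ (d - 1) ≤ volume.real (kakeyaTube δ ω a) := by
  refine (ENNReal.ofReal_le_iff_le_toReal (volume_kakeyaTube_ne_top hd hδ hω a)).1 ?_
  rw [kakeyaTube_eq_solidCylinder]
  exact le_volume_solidCylinder hd (by norm_num) hδ.le hω a

/-- Two tubes whose directions make an angle `θ` meet in a set of length about `δ / θ`. -/
lemma volume_real_kakeyaTube_inter_le (hd : 0 < d) {δ : ℝ} (hδ : 0 < δ)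
    {ω ω' : EuclideanSpace ℝ (Fin d)} (hω : ‖ω‖ = 1) (hω' : ‖ω'‖ = 1) (hne : ω ≠ ω')
    (hclose : ‖ω - ω'‖ ≤ 1 / 4) (a a' : EuclideanSpace ℝ (Fin d)) :
    volume.real (kakeyaTube δ ω a ∩ kakeyaTube δ ω' a') ≤ 4 ^ d * 4 * δ ^ d / ‖ω - ω'‖ := by
  have hpos : 0 < ‖ω - ω'‖ := norm_pos_iff.2 (sub_ne_zero.2 hne)
  rcases (kakeyaTube δ ω a ∩ kakeyaTube δ ω' a').eq_empty_or_nonempty with h | ⟨z, hz, hz'⟩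
  · rw [h]; simp; positivity
  have hsub : kakeyaTube δ ω a ∩ kakeyaTube δ ω' a' ⊆
      solidCylinder (8 * δ / ‖ω - ω'‖) (2 * δ) ω z := by
    rintro y ⟨hy, hy'⟩
    refine ⟨?_, norm_perp_sub_le_of_mem_kakeyaTube hy hz⟩
    have h1 := norm_perp_sub_le_of_mem_kakeyaTube hy hz
    have h2 := norm_perp_sub_le_of_mem_kakeyaTube hy' hz'
    have h3 : inner ℝ (y - z) ω • perp ω' (ω - ω') =
        perp ω' (y - z) - perp ω' (perp ω (y - z)) := by
      conv_rhs => enter [1]; rw [← inner_smul_add_perp ω (y - z)]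
      have := perp_smul_self hω' 1
      rw [one_smul] at this
      rw [map_add, map_smul, map_sub, this]; abel_nf
    have h4 : ‖inner ℝ (y - z) ω • perp ω' (ω - ω')‖ ≤ 4 * δ := by
      rw [h3]
      exact (norm_sub_le _ _).trans (by linarith [norm_perp_le hω' (perp ω (y - z))])
    rw [norm_smul, Real.norm_eq_abs] at h4
    have h5 := norm_sub_le_two_mul_norm_perp hω' hω hω' hclose (by simp)
    rw [le_div_iff₀ hpos]
    nlinarith [abs_nonneg (inner ℝ (y - z) ω)]
  refine ENNReal.toReal_le_of_le_ofReal (by positivity) ((measure_mono hsub).trans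
    ((volume_solidCylinder_le hd (by positivity) (by positivity) hω z).trans
      (ENNReal.ofReal_le_ofReal (le_of_eq ?_))))
  obtain ⟨n, rfl⟩ : ∃ n, d = n + 1 := ⟨d - 1, by omega⟩
  rw [Nat.add_sub_cancel, mul_pow, show (4 : ℝ) = 2 * 2 by norm_num, mul_pow]
  field_simp
  ring

/-- If two tubes meet a third one and meet each other at a point `x` that is far from where the
second one meets the third, then their directions and that of the third are nearly coplanar: any
unit vector orthogonal to two of the directions is nearly orthogonal to the remaining one. -/
lemma abs_inner_mul_abs_inner_le {δ : ℝ} {ω₀ ω ω' a₀ a a' p p' x w : EuclideanSpace ℝ (Fin d)}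
    (hp : p ∈ kakeyaTube δ ω a) (hp₀ : p ∈ kakeyaTube δ ω₀ a₀)
    (hp' : p' ∈ kakeyaTube δ ω' a') (hp₀' : p' ∈ kakeyaTube δ ω₀ a₀)
    (hx : x ∈ kakeyaTube δ ω a) (hx' : x ∈ kakeyaTube δ ω' a')
    (hw : ‖w‖ = 1) (hw₀ : inner ℝ w ω₀ = 0) (hwω : inner ℝ w ω = 0) :
    |inner ℝ (x - p') ω'| * |inner ℝ w ω'| ≤ 6 * δ := by
  have h1 : inner ℝ w (x - p') = inner ℝ w (perp ω (x - p)) + inner ℝ w (perp ω₀ (p - p')) := by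
    rw [← inner_eq_inner_perp hwω, ← inner_eq_inner_perp hw₀, ← inner_add_right]
    congr 1; abel
  have h2 : inner ℝ w (x - p') =
      inner ℝ (x - p') ω' * inner ℝ w ω' + inner ℝ w (perp ω' (x - p')) := by
    conv_lhs => rw [← inner_smul_add_perp ω' (x - p')]
    rw [inner_add_right, inner_smul_right]
  have hb : ∀ v : EuclideanSpace ℝ (Fin d), ‖v‖ ≤ 2 * δ → |inner ℝ w v| ≤ 2 * δ := by
    intro v hv
    refine (abs_real_inner_le_norm _ _).trans ?_
    rwa [hw, one_mul]
  have h3 := abs_le.1 (hb _ (norm_perp_sub_le_of_mem_kakeyaTube hx hp))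
  have h4 := abs_le.1 (hb _ (norm_perp_sub_le_of_mem_kakeyaTube hp₀ hp₀'))
  have h5 := abs_le.1 (hb _ (norm_perp_sub_le_of_mem_kakeyaTube hx' hp'))
  rw [← abs_mul, abs_le]
  constructor <;> linarith [h3.1, h3.2, h4.1, h4.2, h5.1, h5.2]

/-- A `δ`-separated set of unit vectors close to `e`, whose coordinates orthogonal to `e` lie in a
box with sides `r i ≥ δ`, has at most `∏ r i / δ` elements up to a constant. The proof counts the
cells of a grid of mesh comparable to `δ`. -/
lemma card_le_prod_of_separated (hd : 0 < d) {δ : ℝ} (hδ : 0 < δ)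
    (U : Finset (EuclideanSpace ℝ (Fin d)))
    (b : OrthonormalBasis (Fin d) ℝ (EuclideanSpace ℝ (Fin d))) (i₀ : Fin d)
    (hU : ∀ u ∈ U, ‖u‖ = 1) (hclose : ∀ u ∈ U, ‖u - b i₀‖ ≤ 1 / 4)
    (hsep : ∀ u ∈ U, ∀ v ∈ U, u ≠ v → δ ≤ ‖u - v‖) {r : Fin d → ℝ} (hr : ∀ i, δ ≤ r i)
    (c : EuclideanSpace ℝ (Fin d))
    (hbox : ∀ u ∈ U, ∀ i, i ≠ i₀ → |inner ℝ (b i) (u - c)| ≤ r i) :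
    (U.card : ℝ) ≤ ∏ i ∈ Finset.univ.erase i₀, (10 * d * r i / δ) := by
  classical
  have hd' : (1 : ℝ) ≤ d := by exact_mod_cast hd
  set h : ℝ := δ / (4 * d) with hh
  have hpos : 0 < h := by positivity
  let F : EuclideanSpace ℝ (Fin d) → Fin d → ℤ := fun u i =>
    if i = i₀ then 0 else ⌊inner ℝ (b i) (u - c) / h⌋
  let B : Finset (Fin d → ℤ) := Fintype.piFinset fun i =>
    if i = i₀ then {0} else Finset.Icc ⌊-r i / h⌋ ⌊r i / h⌋
  have hmaps : ∀ u ∈ U, F u ∈ B := by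
    intro u hu
    rw [Fintype.mem_piFinset]
    intro i
    by_cases hi : i = i₀
    · simp [F, hi]
    · simp only [F, hi, if_false, Finset.mem_Icc]
      have := abs_le.1 (hbox u hu i hi)
      exact ⟨Int.floor_le_floor (by gcongr; exact this.1),
        Int.floor_le_floor (by gcongr; exact this.2)⟩
  have hinj : Set.InjOn F U := by
    intro u hu v hv huv
    by_contra hne
    have hcoord : ∀ i, |inner ℝ (b i) (perp (b i₀) (u - v))| ≤ h := by
      intro i
      by_cases hi : i = i₀
      · have : inner ℝ (b i) (perp (b i₀) (u - v)) = 0 := by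
          rw [hi, perp_apply, inner_sub_right, inner_smul_right, real_inner_self_eq_norm_sq,
            b.orthonormal.1, real_inner_comm]; ring
        rw [this, abs_zero]; exact hpos.le
      · rw [b.inner_perp_eq hi]
        have h1 : ⌊inner ℝ (b i) (u - c) / h⌋ = ⌊inner ℝ (b i) (v - c) / h⌋ := by
          have := congrFun huv i
          simpa only [F, hi, if_false] using this
        have h2 := Int.abs_sub_lt_one_of_floor_eq_floor h1
        rw [← sub_div, ← inner_sub_right, abs_div, abs_of_pos hpos, div_lt_one hpos] at h2
        simpa using h2.le
    have hle : ‖perp (b i₀) (u - v)‖ ≤ δ / 4 := by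
      rw [← b.sum_repr' (perp (b i₀) (u - v))]
      refine (norm_sum_le _ _).trans ?_
      calc _ ≤ ∑ _i : Fin d, h := Finset.sum_le_sum fun i _ => by
            rw [norm_smul, b.orthonormal.1 i, mul_one]; exact hcoord i
        _ = δ / 4 := by rw [Finset.sum_const, hh]; simp; field_simp
    have := norm_sub_le_two_mul_norm_perp (b.orthonormal.1 i₀) (hU u hu) (hU v hv)
      (hclose u hu) (hclose v hv)
    linarith [hsep u hu v hv hne]
  have hcard : U.card ≤ B.card := Finset.card_le_card_of_injOn F hmaps hinj
  refine (Nat.cast_le.2 hcard).trans ?_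
  rw [Fintype.card_piFinset, ← Finset.mul_prod_erase _ _ (Finset.mem_univ i₀)]
  simp only [if_true, Finset.card_singleton, one_mul, Nat.cast_prod]
  refine Finset.prod_le_prod (fun _ _ => by positivity) fun i hi => ?_
  rw [if_neg (Finset.ne_of_mem_erase hi), Int.card_Icc]
  have hri : 0 < r i := hδ.trans_le (hr i)
  have h1 : (⌊-r i / h⌋ : ℝ) > -r i / h - 1 := Int.sub_one_lt_floor _
  have h2 : (⌊r i / h⌋ : ℝ) ≤ r i / h := Int.floor_le _
  have h3 : (0 : ℝ) ≤ r i / h := by positivity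
  have h4 : 1 ≤ r i / δ := by rw [le_div_iff₀ hδ]; linarith [hr i]
  have h5 : r i / h = 4 * d * (r i / δ) := by rw [hh]; field_simp
  have h7 : (0 : ℤ) ≤ ⌊r i / h⌋ + 1 - ⌊-r i / h⌋ := by
    have : ⌊-r i / h⌋ ≤ ⌊r i / h⌋ := Int.floor_le_floor (by gcongr; linarith)
    omega
  have h6 : ((⌊r i / h⌋ + 1 - ⌊-r i / h⌋).toNat : ℝ) = (⌊r i / h⌋ : ℝ) + 1 - ⌊-r i / h⌋ := by
    rw [← Int.cast_natCast, Int.toNat_of_nonneg h7]; push_cast; ring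
  rw [h6]
  rw [neg_div] at *
  have h8 : 10 * d * r i / δ = 10 * d * (r i / δ) := by ring
  rw [h8]
  nlinarith

/-- A `δ`-separated set of unit vectors in a ball of radius `R` has at most `(R / δ) ^ (d - 1)`
elements up to a constant. -/
lemma card_le_pow_of_separated (hd : 0 < d) {δ R : ℝ} (hδ : 0 < δ) (hR : δ ≤ R)
    (U : Finset (EuclideanSpace ℝ (Fin d))) {e c : EuclideanSpace ℝ (Fin d)} (he : ‖e‖ = 1)
    (hU : ∀ u ∈ U, ‖u‖ = 1) (hclose : ∀ u ∈ U, ‖u - e‖ ≤ 1 / 4)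
    (hsep : ∀ u ∈ U, ∀ v ∈ U, u ≠ v → δ ≤ ‖u - v‖) (hc : ∀ u ∈ U, ‖u - c‖ ≤ R) :
    (U.card : ℝ) ≤ (10 * d * R / δ) ^ (d - 1) := by
  obtain ⟨b, hb⟩ := exists_orthonormalBasis_apply_eq ⟨0, hd⟩ he
  have := card_le_prod_of_separated hd hδ U b ⟨0, hd⟩ hU (by rwa [hb]) hsep (r := fun _ => R)
    (fun _ => hR) c (fun u hu i _ => (abs_real_inner_le_norm _ _).trans (by
      rw [b.orthonormal.1 i, one_mul]; exact hc u hu))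
  simpa [div_pow] using this

end Geometry

/-! ### Integration of counting functions -/

section Counting

open Classical in
lemma sum_indicator_one_eq_card {α ι : Type*} (J : Finset ι) (A : ι → Set α) (x : α) :
    ∑ j ∈ J, (A j).indicator (fun _ => (1 : ℝ)) x = (J.filter fun j => x ∈ A j).card := by
  simp [Set.indicator_apply]

variable {α ι : Type*} [MeasurableSpace α] {μ : Measure α}

open Classical in
lemma sum_measureReal_inter_eq_integral (J : Finset ι) {A : ι → Set α}
    (hA : ∀ j ∈ J, MeasurableSet (A j)) {E : Set α} (hE' : μ E ≠ ∞) :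
    ∑ j ∈ J, μ.real (E ∩ A j) = ∫ x in E, ((J.filter fun j => x ∈ A j).card : ℝ) ∂μ ∧
      IntegrableOn (fun x => ((J.filter fun j => x ∈ A j).card : ℝ)) E μ := by
  have hint : ∀ j ∈ J, IntegrableOn ((A j).indicator fun _ => (1 : ℝ)) E μ := fun j hj =>
    (integrableOn_const hE').indicator (hA j hj)
  simp_rw [← sum_indicator_one_eq_card]
  refine ⟨?_, integrable_finsetSum _ hint⟩
  rw [integral_finsetSum _ hint]
  refine Finset.sum_congr rfl fun j hj => ?_
  rw [integral_indicator (hA j hj), Measure.restrict_restrict (hA j hj)]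
  simp [Set.inter_comm]

open Classical in
lemma mul_measureReal_le_sum (J : Finset ι) {A : ι → Set α}
    (hA : ∀ j ∈ J, MeasurableSet (A j)) {E : Set α} (hE : MeasurableSet E) (hE' : μ E ≠ ∞)
    {c : ℝ} (h : ∀ x ∈ E, c ≤ (J.filter fun j => x ∈ A j).card) :
    c * μ.real E ≤ ∑ j ∈ J, μ.real (E ∩ A j) := by
  obtain ⟨h1, h2⟩ := sum_measureReal_inter_eq_integral J hA hE'
  rw [h1, mul_comm, ← smul_eq_mul, ← setIntegral_const]
  exact setIntegral_mono_on (integrableOn_const hE') h2 hE h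

open Classical in
lemma sum_measureReal_inter_le (J : Finset ι) {A : ι → Set α}
    (hA : ∀ j ∈ J, MeasurableSet (A j)) {E : Set α} (hE : MeasurableSet E) (hE' : μ E ≠ ∞)
    {c : ℝ} (h : ∀ x ∈ E, ((J.filter fun j => x ∈ A j).card : ℝ) ≤ c) :
    ∑ j ∈ J, μ.real (E ∩ A j) ≤ c * μ.real E := by
  obtain ⟨h1, h2⟩ := sum_measureReal_inter_eq_integral J hA hE'
  rw [h1, mul_comm c, ← smul_eq_mul, ← setIntegral_const]
  exact setIntegral_mono_on h2 (integrableOn_const hE') hE h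

/-- Cauchy–Schwarz for the counting function of a family of subsets of `Z`. -/
lemma sq_sum_measureReal_le (J : Finset ι) {Y : ι → Set α}
    (hY : ∀ j ∈ J, MeasurableSet (Y j)) {Z : Set α} (hZ' : μ Z ≠ ∞)
    (hsub : ∀ j ∈ J, Y j ⊆ Z) :
    (∑ j ∈ J, μ.real (Y j)) ^ 2 ≤ μ.real Z * ∑ j ∈ J, ∑ k ∈ J, μ.real (Y j ∩ Y k) := by
  classical
  obtain ⟨h1, h2⟩ := sum_measureReal_inter_eq_integral (μ := μ) J hY hZ'
  obtain ⟨B, hB⟩ : ∃ B : ι × ι → Set α, ∀ p, B p = Y p.1 ∩ Y p.2 := ⟨_, fun _ => rfl⟩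
  obtain ⟨h3, h4⟩ := sum_measureReal_inter_eq_integral (μ := μ) (J ×ˢ J)
    (A := B) (fun p hp => by
      rw [hB]
      exact (hY _ (Finset.mem_product.1 hp).1).inter (hY _ (Finset.mem_product.1 hp).2)) hZ'
  have e1 : ∑ j ∈ J, μ.real (Y j) = ∑ j ∈ J, μ.real (Z ∩ Y j) :=
    Finset.sum_congr rfl fun j hj => by rw [Set.inter_eq_right.2 (hsub j hj)]
  have e2 : ∑ j ∈ J, ∑ k ∈ J, μ.real (Y j ∩ Y k) =
      ∑ p ∈ J ×ˢ J, μ.real (Z ∩ B p) := by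
    rw [Finset.sum_product]
    refine Finset.sum_congr rfl fun j hj => Finset.sum_congr rfl fun k _ => ?_
    rw [hB, Set.inter_eq_right.2 (Set.inter_subset_left.trans (hsub j hj))]
  have e3 : ∀ x, (((J ×ˢ J).filter fun p => x ∈ B p).card : ℝ) =
      ((J.filter fun j => x ∈ Y j).card : ℝ) ^ 2 := by
    intro x
    have : ((J ×ˢ J).filter fun p => x ∈ B p) =
        (J.filter fun j => x ∈ Y j) ×ˢ (J.filter fun j => x ∈ Y j) := by
      rw [← Finset.filter_product]
      exact Finset.filter_congr fun p _ => by rw [hB, Set.mem_inter_iff]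
    rw [this, Finset.card_product]; push_cast; ring
  simp_rw [e3] at h3 h4
  rw [e1, e2, h1, h3]
  set f : α → ℝ := fun x => ((J.filter fun j => x ∈ Y j).card : ℝ) with hf
  have key : ∀ t : ℝ, 0 ≤ μ.real Z * (t * t) + (-2 * ∫ x in Z, f x ∂μ) * t +
      ∫ x in Z, f x ^ 2 ∂μ := by
    intro t
    have : ∫ x in Z, (f x - t) ^ 2 ∂μ = μ.real Z * (t * t) + (-2 * ∫ x in Z, f x ∂μ) * t +
        ∫ x in Z, f x ^ 2 ∂μ := by
      have hc : IntegrableOn (fun _ : α => t ^ 2) Z μ := integrableOn_const hZ'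
      have : ∀ x, (f x - t) ^ 2 = (f x ^ 2 - (2 * t) * f x) + t ^ 2 := fun x => by ring
      simp_rw [this]
      have h5 : Integrable (fun x => f x ^ 2) (μ.restrict Z) := h4
      have h6 : Integrable (fun x => 2 * t * f x) (μ.restrict Z) := h2.const_mul _
      have h7 : Integrable (fun x => f x ^ 2 - 2 * t * f x) (μ.restrict Z) := h5.sub h6
      rw [integral_add h7 hc, integral_sub h5 h6,
        integral_const_mul, setIntegral_const, smul_eq_mul]
      ring
    rw [← this]
    exact integral_nonneg fun x => sq_nonneg _
  have := discrim_le_zero key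
  rw [discrim] at this
  nlinarith

end Counting

/-! ### The hairbrush estimate -/

section Hairbrush

variable {d : ℕ}

/-- The number of bristles of a hairbrush that meet a fixed bristle `ω` away from the stem and make
an angle about `2 ^ k * δ` with it: their directions lie within `δ / s` of the plane spanned by `ω`
and the stem `ω₀`. -/
lemma card_bristles_le (hd : 2 ≤ d) {δ s : ℝ} (hδ : 0 < δ) (hs : 0 < s) (hs1 : s ≤ 1) (k : ℕ)
    {ω₀ ω a₀ p : EuclideanSpace ℝ (Fin d)} (a q : EuclideanSpace ℝ (Fin d) →
      EuclideanSpace ℝ (Fin d)) (hω₀ : ‖ω₀‖ = 1) (hω : ‖ω‖ = 1) (hne : ω ≠ ω₀)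
    (hclose : ‖ω - ω₀‖ ≤ 1 / 4) (hp : p ∈ kakeyaTube δ ω (a ω)) (hp₀ : p ∈ kakeyaTube δ ω₀ a₀)
    (U : Finset (EuclideanSpace ℝ (Fin d))) (hU : ∀ u ∈ U, ‖u‖ = 1)
    (hUclose : ∀ u ∈ U, ‖u - ω₀‖ ≤ 1 / 4)
    (hsep : ∀ u ∈ U, ∀ v ∈ U, u ≠ v → δ ≤ ‖u - v‖)
    (hring : ∀ u ∈ U, ‖ω - u‖ ≤ 2 ^ (k + 1) * δ)
    (hq : ∀ u ∈ U, q u ∈ kakeyaTube δ u (a u) ∧ q u ∈ kakeyaTube δ ω₀ a₀)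
    (hmeet : ∀ u ∈ U, ∃ x ∈ kakeyaTube δ ω (a ω) ∩ kakeyaTube δ u (a u),
      s ≤ |inner ℝ (x - q u) u|) :
    (U.card : ℝ) ≤ 20 * d * 2 ^ k * (60 * d / s) ^ (d - 2) := by
  set i₀ : Fin d := ⟨0, by omega⟩ with hi₀
  set i₁ : Fin d := ⟨1, by omega⟩ with hi₁
  have hi : i₀ ≠ i₁ := by simp [hi₀, hi₁]
  have hperp : 0 < ‖perp ω₀ ω‖ := by
    have h1 := norm_sub_le_two_mul_norm_perp hω₀ hω hω₀ hclose (by simp)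
    have h2 := perp_smul_self hω₀ 1
    rw [one_smul] at h2
    rw [map_sub, h2, sub_zero] at h1
    have : 0 < ‖ω - ω₀‖ := norm_pos_iff.2 (sub_ne_zero.2 hne)
    linarith
  set f := (‖perp ω₀ ω‖)⁻¹ • perp ω₀ ω with hf
  have hf1 : ‖f‖ = 1 := by
    rw [hf, norm_smul, norm_inv, norm_norm, inv_mul_cancel₀ hperp.ne']
  have hf0 : inner ℝ ω₀ f = 0 := by
    rw [hf, inner_smul_right, perp_apply, inner_sub_right, inner_smul_right,
      real_inner_self_eq_norm_sq, hω₀, real_inner_comm]; ring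
  obtain ⟨b, hb0, hb1⟩ := exists_orthonormalBasis_apply_eq₂ hi hω₀ hf1 hf0
  have horth : ∀ i, i ≠ i₀ → i ≠ i₁ → inner ℝ (b i) ω₀ = 0 ∧ inner ℝ (b i) ω = 0 := by
    intro i h0 h1
    have e0 : inner ℝ (b i) ω₀ = 0 := by rw [← hb0]; exact b.orthonormal.2 h0
    have e1 : inner ℝ (b i) f = 0 := by rw [← hb1]; exact b.orthonormal.2 h1
    refine ⟨e0, ?_⟩
    rw [inner_eq_inner_perp e0]
    rw [hf, inner_smul_right] at e1
    exact (mul_eq_zero.1 e1).resolve_left (inv_ne_zero hperp.ne')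
  set r : Fin d → ℝ := fun i => if i = i₁ then 2 ^ (k + 1) * δ else 6 * δ / s with hr
  have hrδ : ∀ i, δ ≤ r i := by
    intro i
    simp only [hr]
    split_ifs
    · have : (1 : ℝ) ≤ 2 ^ (k + 1) := one_le_pow₀ (by norm_num)
      nlinarith
    · rw [le_div_iff₀ hs]; nlinarith
  have hbox : ∀ u ∈ U, ∀ i, i ≠ i₀ → |inner ℝ (b i) (u - ω)| ≤ r i := by
    intro u hu i h0
    simp only [hr]
    split_ifs with h1
    · refine (abs_real_inner_le_norm _ _).trans ?_
      rw [b.orthonormal.1 i, one_mul, norm_sub_rev]; exact hring u hu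
    · obtain ⟨e0, e1⟩ := horth i h0 h1
      rw [inner_sub_right, e1, sub_zero]
      obtain ⟨x, hx, hxs⟩ := hmeet u hu
      have := abs_inner_mul_abs_inner_le hp hp₀ (hq u hu).1 (hq u hu).2 hx.1 hx.2
        (b.orthonormal.1 i) e0 e1
      rw [le_div_iff₀ hs]
      nlinarith [abs_nonneg (inner ℝ (b i) u)]
  refine (card_le_prod_of_separated (by omega) hδ U b i₀ hU (by rwa [hb0]) hsep hrδ ω
    hbox).trans (le_of_eq ?_)
  rw [← Finset.mul_prod_erase _ _ (Finset.mem_erase.2 ⟨hi.symm, Finset.mem_univ i₁⟩),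
    Finset.prod_congr rfl (g := fun _ => 60 * d / s)]
  · rw [Finset.prod_const, Finset.card_erase_of_mem (by simp [hi.symm]),
      Finset.card_erase_of_mem (Finset.mem_univ _), Finset.card_univ, Fintype.card_fin,
      Nat.sub_sub]
    simp only [hr, if_true]
    field_simp
    ring
  · intro i hi
    simp only [hr]
    rw [if_neg (Finset.ne_of_mem_erase hi)]
    field_simp
    ring

/-- Distances between points of a `δ`-separated set of diameter at most `1 / 4` lie in `K` dyadic
rings when `2 ^ K * δ ≥ 1`. -/
lemma exists_ring {δ t : ℝ} {K : ℕ} (hK : 1 ≤ 2 ^ K * δ) (h1 : δ ≤ t)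
    (h2 : t ≤ 1 / 4) : ∃ k ∈ Finset.range K, 2 ^ k * δ ≤ t ∧ t < 2 ^ (k + 1) * δ := by
  have hex : ∃ n : ℕ, t < 2 ^ n * δ := ⟨K, by linarith⟩
  classical
  have h3 := Nat.find_spec hex
  have h4 : Nat.find hex ≤ K := Nat.find_min' hex (by linarith)
  obtain ⟨n, hn⟩ : ∃ n, Nat.find hex = n + 1 := Nat.exists_eq_succ_of_ne_zero (by
    intro h0; rw [h0] at h3; simp at h3; linarith)
  rw [hn] at h3 h4
  exact ⟨n, Finset.mem_range.2 h4, not_lt.1 (Nat.find_min hex (by omega)), h3⟩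

lemma sum_le_add_sum_rings {E : Type*} [NormedAddCommGroup E] {δ : ℝ} {K : ℕ}
    (hK : 1 ≤ 2 ^ K * δ) (H : Finset E) [DecidableEq E]
    {ω : E} (hsep : ∀ u ∈ H, ω ≠ u → δ ≤ ‖ω - u‖)
    (hdiam : ∀ u ∈ H, ‖ω - u‖ ≤ 1 / 4) {f : E → ℝ} (hf : ∀ u ∈ H, 0 ≤ f u) (P : E → Prop)
    [DecidablePred P] (hP : ∀ u ∈ H, ¬ P u → f u = 0) (hω : 0 ≤ f ω) :
    ∑ u ∈ H, f u ≤ f ω + ∑ k ∈ Finset.range K,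
      ∑ u ∈ H.filter (fun u => (2 ^ k * δ ≤ ‖ω - u‖ ∧ ‖ω - u‖ < 2 ^ (k + 1) * δ) ∧ P u), f u := by
  have hsub : H ⊆ insert ω (H.erase ω) := fun u hu => by
    by_cases h : u = ω <;> simp [h, hu]
  refine (Finset.sum_le_sum_of_subset_of_nonneg hsub (fun u hu _ => ?_)).trans ?_
  · rcases Finset.mem_insert.1 hu with rfl | h
    · exact hω
    · exact hf _ (Finset.mem_of_mem_erase h)
  rw [Finset.sum_insert (Finset.notMem_erase _ _)]
  gcongr
  simp_rw [Finset.sum_filter]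
  rw [Finset.sum_comm]
  refine (Finset.sum_le_sum (fun u hu => ?_)).trans
    (Finset.sum_le_sum_of_subset_of_nonneg (Finset.erase_subset ω H) (fun u hu _ => ?_))
  · have huH := Finset.mem_of_mem_erase hu
    by_cases hPu : P u
    · obtain ⟨k, hk, hk'⟩ := exists_ring hK
        (hsep u huH (Finset.ne_of_mem_erase hu).symm) (hdiam u huH)
      refine le_trans (le_of_eq ?_) (Finset.single_le_sum (fun j _ => ?_) hk)
      · rw [if_pos ⟨hk', hPu⟩]
      · split_ifs
        · exact hf u huH
        · exact le_rfl
    · rw [hP u huH hPu]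
      exact Finset.sum_nonneg fun j _ => by simp [hPu]
  · exact Finset.sum_nonneg fun j _ => by
      split_ifs
      · exact hf u hu
      · exact le_rfl

end Hairbrush

section Hairbrush

variable {d : ℕ}

/-- Row sums of the overlap matrix of a hairbrush, from each of whose bristles `u` the part at
axial distance less than `s` from a point `q u` of the stem has been removed: Córdoba's planar estimate, with a loss of `s ^ (2 - d)`. -/
lemma sum_measureReal_bristle_inter_le (hd : 2 ≤ d) {δ s : ℝ} (hδ : 0 < δ) (hs : 0 < s)
    (hs1 : s ≤ 1) {K : ℕ} (hK1 : 1 ≤ K) (hK : 1 ≤ 2 ^ K * δ)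
    {ω₀ ω a₀ : EuclideanSpace ℝ (Fin d)} (a q : EuclideanSpace ℝ (Fin d) →
      EuclideanSpace ℝ (Fin d)) (hω₀ : ‖ω₀‖ = 1)
    (H : Finset (EuclideanSpace ℝ (Fin d))) (hH : ∀ u ∈ H, ‖u‖ = 1)
    (hne : ∀ u ∈ H, u ≠ ω₀) (hclose : ∀ u ∈ H, ‖u - ω₀‖ ≤ 1 / 4)
    (hdiam : ∀ u ∈ H, ∀ v ∈ H, ‖u - v‖ ≤ 1 / 4)
    (hsep : ∀ u ∈ H, ∀ v ∈ H, u ≠ v → δ ≤ ‖u - v‖)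
    (hq : ∀ u ∈ H, q u ∈ kakeyaTube δ u (a u) ∧ q u ∈ kakeyaTube δ ω₀ a₀)
    (Y : EuclideanSpace ℝ (Fin d) → Set (EuclideanSpace ℝ (Fin d)))
    (hY : ∀ u ∈ H, Y u ⊆ kakeyaTube δ u (a u))
    (hYs : ∀ u ∈ H, ∀ x ∈ Y u, s ≤ |inner ℝ (x - q u) u|) (hω : ω ∈ H) :
    ∑ u ∈ H, volume.real (Y ω ∩ Y u) ≤
      K * ((2 ^ d + 4 ^ d * 80 * d * (60 * d) ^ (d - 2)) / s ^ (d - 2) * δ ^ (d - 1)) := by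
  classical
  have hd0 : 0 < d := by omega
  have hδd : δ ^ d = δ * δ ^ (d - 1) := by
    conv_lhs => rw [← Nat.sub_add_cancel hd0, pow_succ']
  refine (sum_le_add_sum_rings hK H (hsep ω hω) (hdiam ω hω)
    (f := fun u => volume.real (Y ω ∩ Y u)) (fun u _ => measureReal_nonneg)
    (fun u => (Y ω ∩ Y u).Nonempty) (fun u _ hu => ?_) measureReal_nonneg).trans ?_
  · simp [Set.not_nonempty_iff_eq_empty.1 hu]
  have hself : volume.real (Y ω ∩ Y ω) ≤ 2 ^ d / s ^ (d - 2) * δ ^ (d - 1) := by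
    rw [Set.inter_self]
    refine (measureReal_mono (hY ω hω) (volume_kakeyaTube_ne_top hd0 hδ (hH ω hω) _)).trans
      ((volume_real_kakeyaTube_le hd0 hδ (hH ω hω) _).trans ?_)
    gcongr
    exact le_div_self (by positivity) (by positivity) (pow_le_one₀ hs.le hs1)
  have hringk : ∀ k ∈ Finset.range K, ∑ u ∈ H.filter (fun u => (2 ^ k * δ ≤ ‖ω - u‖ ∧
      ‖ω - u‖ < 2 ^ (k + 1) * δ) ∧ (Y ω ∩ Y u).Nonempty), volume.real (Y ω ∩ Y u) ≤
      4 ^ d * 80 * d * (60 * d) ^ (d - 2) / s ^ (d - 2) * δ ^ (d - 1) := by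
    intro k _
    set R := H.filter (fun u => (2 ^ k * δ ≤ ‖ω - u‖ ∧
      ‖ω - u‖ < 2 ^ (k + 1) * δ) ∧ (Y ω ∩ Y u).Nonempty) with hR
    have hRH : ∀ u ∈ R, u ∈ H := fun u hu => (Finset.mem_filter.1 hu).1
    have hcard : (R.card : ℝ) ≤ 20 * d * 2 ^ k * (60 * d / s) ^ (d - 2) := by
      refine card_bristles_le hd hδ hs hs1 k a q hω₀ (hH ω hω) (hne ω hω) (hclose ω hω)
        (hq ω hω).1 (hq ω hω).2 R (fun u hu => hH u (hRH u hu))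
        (fun u hu => hclose u (hRH u hu))
        (fun u hu v hv => hsep u (hRH u hu) v (hRH v hv))
        (fun u hu => (Finset.mem_filter.1 hu).2.1.2.le) (fun u hu => hq u (hRH u hu)) ?_
      intro u hu
      obtain ⟨x, hx, hx'⟩ := (Finset.mem_filter.1 hu).2.2
      exact ⟨x, ⟨hY ω hω hx, hY u (hRH u hu) hx'⟩, hYs u (hRH u hu) x hx'⟩
    have hterm : ∀ u ∈ R, volume.real (Y ω ∩ Y u) ≤ 4 ^ d * 4 * δ ^ d / (2 ^ k * δ) := by
      intro u hu
      have hr := (Finset.mem_filter.1 hu).2.1.1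
      have hpos : 0 < 2 ^ k * δ := by positivity
      have huω : ω ≠ u := by
        rintro rfl
        rw [sub_self, norm_zero] at hr; linarith
      refine (measureReal_mono (Set.inter_subset_inter (hY ω hω) (hY u (hRH u hu)))
        (measure_ne_top_of_subset Set.inter_subset_left
          (volume_kakeyaTube_ne_top hd0 hδ (hH ω hω) _))).trans
        ((volume_real_kakeyaTube_inter_le hd0 hδ (hH ω hω) (hH u (hRH u hu)) huω
          (hdiam ω hω u (hRH u hu)) _ _).trans ?_)
      gcongr
    refine (Finset.sum_le_card_nsmul _ _ _ hterm).trans ?_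
    rw [nsmul_eq_mul]
    refine (mul_le_mul_of_nonneg_right hcard (by positivity)).trans (le_of_eq ?_)
    rw [hδd, div_pow]
    field_simp
    ring
  refine (add_le_add hself (Finset.sum_le_card_nsmul _ _ _ hringk)).trans ?_
  rw [Finset.card_range, nsmul_eq_mul]
  have hK1' : (1 : ℝ) ≤ K := by exact_mod_cast hK1
  have : 2 ^ d / s ^ (d - 2) * δ ^ (d - 1) ≤ K * (2 ^ d / s ^ (d - 2) * δ ^ (d - 1)) :=
    le_mul_of_one_le_left (by positivity) hK1'
  refine (add_le_add_left this _).trans (le_of_eq ?_)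
  ring

/-- Wolff's hairbrush estimate: if tubes with `δ`-separated directions all meet a common stem and
each has density at least `l` in `Z`, then the volume of `Z` is at least, up to a logarithmic
factor `K`, `l ^ d` times the total volume of the tubes. -/
lemma exists_hairbrush_const (hd : 2 ≤ d) : ∃ c : ℝ, 0 < c ∧ ∀ {δ l : ℝ}, 0 < δ → 0 < l → l ≤ 1 →
    ∀ {K : ℕ}, 1 ≤ K → 1 ≤ 2 ^ K * δ → ∀ {ω₀ a₀ : EuclideanSpace ℝ (Fin d)}
    (a : EuclideanSpace ℝ (Fin d) → EuclideanSpace ℝ (Fin d)), ‖ω₀‖ = 1 →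
    ∀ H : Finset (EuclideanSpace ℝ (Fin d)), (∀ u ∈ H, ‖u‖ = 1) → (∀ u ∈ H, u ≠ ω₀) →
    (∀ u ∈ H, ‖u - ω₀‖ ≤ 1 / 4) → (∀ u ∈ H, ∀ v ∈ H, ‖u - v‖ ≤ 1 / 4) →
    (∀ u ∈ H, ∀ v ∈ H, u ≠ v → δ ≤ ‖u - v‖) →
    (∀ u ∈ H, (kakeyaTube δ u (a u) ∩ kakeyaTube δ ω₀ a₀).Nonempty) →
    ∀ Z : Set (EuclideanSpace ℝ (Fin d)), MeasurableSet Z → volume Z ≠ ∞ →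
    (∀ u ∈ H, l * volume.real (kakeyaTube δ u (a u)) ≤
      volume.real (Z ∩ kakeyaTube δ u (a u))) →
    c * l ^ d * δ ^ (d - 1) * H.card ≤ K * volume.real Z := by
  have hd0 : 0 < d := by omega
  have hdR : (1 : ℝ) ≤ d := by exact_mod_cast hd0
  set A : ℝ := 2 ^ d + 4 ^ d * 80 * d * (60 * d) ^ (d - 2) with hA
  have hApos : 0 < A := by positivity
  -- the fraction of length removed around the stem, chosen so that at most half of the
  -- density is lost
  set g : ℝ := 1 / (2 ^ (d + 1) * d ^ (d - 1)) with hg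
  have hgpos : 0 < g := by positivity
  have hg1 : g ≤ 1 := by
    rw [hg, div_le_one (by positivity)]
    exact one_le_mul_of_one_le_of_one_le (one_le_pow₀ (by norm_num)) (one_le_pow₀ hdR)
  set t : ℝ := 2 ^ d * (1 / 2) * (1 / d) ^ (d - 1) with ht
  have htpos : 0 < t := by positivity
  refine ⟨t ^ 2 * g ^ (d - 2) / (4 * A), by positivity, ?_⟩
  intro δ l hδ hl hl1 K hK1 hK ω₀ a₀ a hω₀ H hH hne hclose hdiam hsep hmeet Z hZ hZ' hdens
  rcases H.eq_empty_or_nonempty with rfl | hHne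
  · simp; positivity
  choose! q hq using hmeet
  set s : ℝ := g * l with hs
  have hspos : 0 < s := by positivity
  have hs1 : s ≤ 1 := by nlinarith
  set Y : EuclideanSpace ℝ (Fin d) → Set (EuclideanSpace ℝ (Fin d)) := fun u =>
    (Z ∩ kakeyaTube δ u (a u)) \ {x | |inner ℝ (x - q u) u| < s} with hYdef
  have hmeas : ∀ u, MeasurableSet {x : EuclideanSpace ℝ (Fin d) | |inner ℝ (x - q u) u| < s} :=
    fun u => (isOpen_lt (by fun_prop) continuous_const).measurableSet
  have hYlow : ∀ u ∈ H, l / 2 * t * δ ^ (d - 1) ≤ volume.real (Y u) := by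
    intro u hu
    have hfin := volume_kakeyaTube_ne_top hd0 hδ (hH u hu) (a u)
    have h1 := le_volume_real_kakeyaTube hd0 hδ (hH u hu) (a u)
    have h2 := hdens u hu
    have h3 : (Z ∩ kakeyaTube δ u (a u)) ∩ {x | |inner ℝ (x - q u) u| < s} ⊆
        solidCylinder s (2 * δ) u (q u) := by
      rintro x ⟨⟨_, hx⟩, hxs⟩
      exact ⟨le_of_lt hxs, norm_perp_sub_le_of_mem_kakeyaTube hx (hq u hu).1⟩
    have h4 : volume.real ((Z ∩ kakeyaTube δ u (a u)) ∩ {x | |inner ℝ (x - q u) u| < s}) ≤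
        2 ^ d * s * (2 * δ) ^ (d - 1) :=
      ENNReal.toReal_le_of_le_ofReal (by positivity) ((measure_mono h3).trans
        (volume_solidCylinder_le hd0 hspos.le (by positivity) (hH u hu) _))
    have h5 := measureReal_inter_add_sdiff (μ := volume)
      (s := Z ∩ kakeyaTube δ u (a u)) (hmeas u)
      (h := measure_ne_top_of_subset Set.inter_subset_right hfin)
    have h6 : 2 ^ d * s * (2 * δ) ^ (d - 1) = l / 2 * t * δ ^ (d - 1) := by
      rw [hs, hg, ht, one_div_pow]
      obtain ⟨n, rfl⟩ : ∃ n, d = n + 1 := ⟨d - 1, by omega⟩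
      simp only [Nat.add_sub_cancel, mul_pow, pow_succ]
      field_simp
    have h7 : l * (2 ^ d * (1 / 2) * (δ / d) ^ (d - 1)) = l * t * δ ^ (d - 1) := by
      rw [ht, div_pow, one_div_pow]; field_simp
    have h8 := (mul_le_mul_of_nonneg_left h1 hl.le).trans h2
    rw [h7] at h8
    change _ ≤ volume.real ((Z ∩ kakeyaTube δ u (a u)) \ _)
    linarith
  have hrow := fun u (hu : u ∈ H) => sum_measureReal_bristle_inter_le hd hδ hspos hs1 hK1 hK a q
    hω₀ H hH hne hclose hdiam hsep hq Y
    (fun u _ => Set.sdiff_subset.trans Set.inter_subset_right)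
    (fun u _ x hx => not_lt.1 hx.2) hu
  have hCS := sq_sum_measureReal_le (μ := volume) H (Y := Y) (fun u _ =>
    (hZ.inter (measurableSet_kakeyaTube _ _ _)).diff (hmeas u)) hZ'
    (fun u _ => Set.sdiff_subset.trans Set.inter_subset_left)
  have hn : (0 : ℝ) < H.card := by exact_mod_cast hHne.card_pos
  have hlow : H.card * (l / 2 * t * δ ^ (d - 1)) ≤ ∑ u ∈ H, volume.real (Y u) := by
    rw [← nsmul_eq_mul]; exact Finset.card_nsmul_le_sum _ _ _ hYlow
  have hup := Finset.sum_le_card_nsmul _ _ _ hrow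
  rw [nsmul_eq_mul] at hup
  have hfinal : (H.card * (l / 2 * t * δ ^ (d - 1))) ^ 2 ≤
      volume.real Z * (H.card * (K * (A / s ^ (d - 2) * δ ^ (d - 1)))) :=
    (pow_le_pow_left₀ (by positivity) hlow 2).trans
      (hCS.trans (mul_le_mul_of_nonneg_left hup measureReal_nonneg))
  have hld : l ^ d = l ^ 2 * l ^ (d - 2) := by rw [← pow_add]; congr 1; omega
  have hδ' : 0 < δ ^ (d - 1) := by positivity
  have e1 : t ^ 2 * g ^ (d - 2) / (4 * A) * l ^ d * δ ^ (d - 1) * H.card *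
      (H.card * (A / s ^ (d - 2) * δ ^ (d - 1))) = (H.card * (l / 2 * t * δ ^ (d - 1))) ^ 2 := by
    rw [hld, hs, mul_pow]
    field_simp
    ring
  refine le_of_mul_le_mul_right ?_
    (show 0 < (H.card : ℝ) * (A / s ^ (d - 2) * δ ^ (d - 1)) by positivity)
  rw [e1]
  refine hfinal.trans (le_of_eq ?_)
  ring

end Hairbrush

/-! ### Pairs of tubes at a given angle -/

section Cap

variable {d : ℕ}

open Classical in
/-- The number of tubes of the family `u ↦ kakeyaTube δ u (a u)`, `u ∈ Ω`, through `x`. -/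
noncomputable def tubeCount (δ : ℝ) (a : EuclideanSpace ℝ (Fin d) → EuclideanSpace ℝ (Fin d))
    (Ω : Finset (EuclideanSpace ℝ (Fin d))) (x : EuclideanSpace ℝ (Fin d)) : ℕ :=
  (Ω.filter fun u => x ∈ kakeyaTube δ u (a u)).card

open Classical in
/-- The number of ordered pairs of tubes of the family through `x` whose directions are at a
distance between `θ` and `2 * θ`. -/
noncomputable def pairCount (δ θ : ℝ) (a : EuclideanSpace ℝ (Fin d) → EuclideanSpace ℝ (Fin d))
    (Ω : Finset (EuclideanSpace ℝ (Fin d))) (x : EuclideanSpace ℝ (Fin d)) : ℕ :=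
  (((Ω ×ˢ Ω).filter fun p => θ ≤ ‖p.1 - p.2‖ ∧ ‖p.1 - p.2‖ < 2 * θ).filter
    fun p => x ∈ kakeyaTube δ p.1 (a p.1) ∩ kakeyaTube δ p.2 (a p.2)).card

/-- The upper bound for the number of bristles coming from the hairbrush estimate, compared with the
lower bound coming from the pairs of tubes and solved for the volume `X`. Here `P` and `Q * P` stand
for `δ ^ (d - 1)` and an upper bound for the volume of a tube. -/
lemma le_of_bristle_bounds {d : ℕ} {c X μ b θ δ P Q A K N : ℝ} (hc : 0 < c) (hX : 0 < X)
    (hθ : 0 < θ) (hδ : 0 < δ) (hP : 0 < P) (hQ : 0 < Q) (hN : 0 < N)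
    (h : (c * (b ^ 2 * μ * X / (4 * N * (Q * P))) ^ d * P) * (b ^ 2 * μ ^ 2 * X / 2 / N) ≤
      K * X * (A * (δ * P) / θ)) :
    X ^ d * μ ^ (d + 2) * b ^ (2 * d + 2) * (θ / δ) ≤
      2 * A * (4 * Q) ^ d / c * K * N ^ (d + 1) * P ^ d := by
  set M := 2 * N * (4 * N * (Q * P)) ^ d * θ / (c * P * δ * X) with hM
  have hM0 : 0 ≤ M := by positivity
  refine (le_of_eq ?_).trans ((mul_le_mul_of_nonneg_right h hM0).trans (le_of_eq ?_))
  · rw [hM, div_pow]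
    field_simp
    ring
  · rw [hM]
    field_simp
    ring

/-- A set in which every point lies on about `(b * μ) ^ 2` pairs of tubes at angle about `θ`, but
on at most `2 * μ` tubes. A popular tube serves as the stem of a hairbrush; bristles of low density
are discarded first, which costs at most half of the pairs. -/
lemma exists_pair_const (hd : 2 ≤ d) : ∃ C : ℝ, 0 < C ∧ ∀ {δ θ μ b : ℝ}, 0 < δ → δ ≤ θ → 0 < μ →
    0 < b → ∀ {K : ℕ}, 1 ≤ K → 1 ≤ 2 ^ K * δ →
    ∀ (a : EuclideanSpace ℝ (Fin d) → EuclideanSpace ℝ (Fin d))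
    (Ω : Finset (EuclideanSpace ℝ (Fin d))), (∀ u ∈ Ω, ‖u‖ = 1) →
    (∀ u ∈ Ω, ∀ v ∈ Ω, ‖u - v‖ ≤ 1 / 4) →
    (∀ u ∈ Ω, ∀ v ∈ Ω, u ≠ v → δ ≤ ‖u - v‖) →
    ∀ E : Set (EuclideanSpace ℝ (Fin d)), MeasurableSet E → volume E ≠ ∞ →
    (∀ x ∈ E, (tubeCount δ a Ω x : ℝ) ≤ 2 * μ) →
    (∀ x ∈ E, b ^ 2 * μ ^ 2 ≤ pairCount δ θ a Ω x) →
    volume.real E ^ d * μ ^ (d + 2) * b ^ (2 * d + 2) * (θ / δ) ≤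
      C * K * Ω.card ^ (d + 1) * (δ ^ (d - 1)) ^ d := by
  classical
  have hd0 : 0 < d := by omega
  obtain ⟨c, hc, hbrush⟩ := exists_hairbrush_const hd
  refine ⟨2 * (4 ^ d * 4) * (4 * 2 ^ d) ^ d / c, by positivity, ?_⟩
  intro δ θ μ b hδ hθ hμ hb K hK1 hK a Ω hΩ hdiam hsep E hE hE' hmult hpair
  have hθ0 : 0 < θ := hδ.trans_le hθ
  set X := volume.real E with hX
  rcases (measureReal_nonneg (μ := volume) (s := E)).eq_or_lt with h0 | hXpos
  · rw [hX, ← h0, zero_pow hd0.ne']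
    simp only [zero_mul]; positivity
  rw [← hX] at hXpos
  set T : EuclideanSpace ℝ (Fin d) → Set (EuclideanSpace ℝ (Fin d)) :=
    fun u => kakeyaTube δ u (a u) with hT
  have hTm : ∀ u, MeasurableSet (T u) := fun u => measurableSet_kakeyaTube _ _ _
  set J := (Ω ×ˢ Ω).filter fun p => θ ≤ ‖p.1 - p.2‖ ∧ ‖p.1 - p.2‖ < 2 * θ with hJ
  set N : ℝ := (Ω.card : ℝ) with hN
  set τ : ℝ := 2 ^ d * δ ^ (d - 1) with hτ
  have hτpos : 0 < τ := by positivity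
  have hTle : ∀ u ∈ Ω, volume.real (T u) ≤ τ := fun u hu =>
    volume_real_kakeyaTube_le hd0 hδ (hΩ u hu) _
  have hTfin : ∀ u ∈ Ω, volume (T u) ≠ ∞ := fun u hu =>
    volume_kakeyaTube_ne_top hd0 hδ (hΩ u hu) _
  obtain ⟨B, hB⟩ : ∃ B : EuclideanSpace ℝ (Fin d) × EuclideanSpace ℝ (Fin d) →
    Set (EuclideanSpace ℝ (Fin d)), ∀ p, B p = T p.1 ∩ T p.2 := ⟨_, fun _ => rfl⟩
  have hS : b ^ 2 * μ ^ 2 * X ≤ ∑ p ∈ J, volume.real (E ∩ B p) := by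
    refine mul_measureReal_le_sum J (fun p _ => by rw [hB]; exact (hTm _).inter (hTm _)) hE hE'
      fun x hx => (hpair x hx).trans (le_of_eq ?_)
    unfold pairCount
    congr 2
    exact Finset.filter_congr fun p _ => by rw [hB]
  have hJsum : ∑ p ∈ J, volume.real (E ∩ B p) = ∑ u ∈ Ω,
      ∑ v ∈ Ω.filter (fun v => θ ≤ ‖u - v‖ ∧ ‖u - v‖ < 2 * θ),
        volume.real (E ∩ (T u ∩ T v)) := by
    rw [hJ, Finset.sum_filter, Finset.sum_product]
    refine Finset.sum_congr rfl fun u _ => ?_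
    rw [Finset.sum_filter]
    exact Finset.sum_congr rfl fun v _ => by simp only [hB]
  -- each tube meets the others in `E` with total mass at most `2 * μ` times its own
  have hcol : ∀ v ∈ Ω, ∑ u ∈ Ω, volume.real (E ∩ (T u ∩ T v)) ≤
      2 * μ * volume.real (E ∩ T v) := by
    intro v hv
    have := sum_measureReal_inter_le (μ := volume) Ω (A := T) (fun u _ => hTm u)
      (hE.inter (hTm v)) (measure_ne_top_of_subset Set.inter_subset_left hE') (c := 2 * μ)
      (fun x hx => hmult x hx.1)
    refine le_trans (le_of_eq (Finset.sum_congr rfl fun u _ => ?_)) this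
    congr 1
    rw [Set.inter_assoc, Set.inter_comm (T u)]
  set l : ℝ := b ^ 2 * μ * X / (4 * N * τ) with hl
  set D : ℝ := b ^ 2 * μ ^ 2 * X with hD
  have hDpos : 0 < D := by positivity
  have hNpos : 0 < N := by
    rcases Ω.eq_empty_or_nonempty with h | h
    · rw [hJsum, h, Finset.sum_empty] at hS; linarith
    · rw [hN]; exact_mod_cast h.card_pos
  have hlpos : 0 < l := by positivity
  have hlN : N * (2 * μ * (l * τ)) = D / 2 := by
    rw [hl, hD]; field_simp; ring
  have hl1 : l ≤ 1 := by
    have h1 : D ≤ N * (2 * μ * τ) := by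
      refine hS.trans ?_
      rw [hJsum]
      calc _ ≤ ∑ u ∈ Ω, ∑ v ∈ Ω, volume.real (E ∩ (T u ∩ T v)) :=
            Finset.sum_le_sum fun u _ => Finset.sum_le_sum_of_subset_of_nonneg
              (Finset.filter_subset _ _) fun _ _ _ => measureReal_nonneg
        _ = ∑ v ∈ Ω, ∑ u ∈ Ω, volume.real (E ∩ (T u ∩ T v)) := Finset.sum_comm
        _ ≤ ∑ v ∈ Ω, 2 * μ * τ := by
            refine Finset.sum_le_sum fun v hv => (hcol v hv).trans ?_
            gcongr
            exact (measureReal_mono Set.inter_subset_right (hTfin v hv)).trans (hTle v hv)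
        _ = _ := by rw [Finset.sum_const, nsmul_eq_mul]
    have h2 : l * (N * (2 * μ * τ)) ≤ 1 * (N * (2 * μ * τ)) := by nlinarith
    exact le_of_mul_le_mul_right h2 (by positivity)
  set G := Ω.filter fun v => l * volume.real (T v) ≤ volume.real (E ∩ T v) with hG
  have hgood : D / 2 ≤ ∑ u ∈ Ω, ∑ v ∈ G.filter (fun v => θ ≤ ‖u - v‖ ∧ ‖u - v‖ < 2 * θ),
        volume.real (E ∩ (T u ∩ T v)) := by
    have hsplit : ∀ u ∈ Ω, ∑ v ∈ Ω.filter (fun v => θ ≤ ‖u - v‖ ∧ ‖u - v‖ < 2 * θ),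
        volume.real (E ∩ (T u ∩ T v)) ≤
        ∑ v ∈ G.filter (fun v => θ ≤ ‖u - v‖ ∧ ‖u - v‖ < 2 * θ),
          volume.real (E ∩ (T u ∩ T v)) +
        ∑ v ∈ Ω.filter (fun v => ¬ l * volume.real (T v) ≤ volume.real (E ∩ T v)),
          volume.real (E ∩ (T u ∩ T v)) := by
      intro u _
      rw [← Finset.sum_filter_add_sum_filter_not (Ω.filter _)
        (fun v => l * volume.real (T v) ≤ volume.real (E ∩ T v)), Finset.filter_comm]
      gcongr
      exact Finset.filter_subset _ _
    have hbad : ∑ u ∈ Ω, ∑ v ∈ Ω.filter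
        (fun v => ¬ l * volume.real (T v) ≤ volume.real (E ∩ T v)),
          volume.real (E ∩ (T u ∩ T v)) ≤ D / 2 := by
      rw [Finset.sum_comm, ← hlN]
      calc _ ≤ ∑ v ∈ Ω.filter (fun v => ¬ l * volume.real (T v) ≤ volume.real (E ∩ T v)),
              2 * μ * (l * τ) := by
            refine Finset.sum_le_sum fun v hv => ?_
            obtain ⟨hv, hv'⟩ := Finset.mem_filter.1 hv
            refine (hcol v hv).trans ?_
            gcongr
            exact (not_le.1 hv').le.trans (mul_le_mul_of_nonneg_left (hTle v hv) hlpos.le)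
        _ ≤ _ := by
            rw [Finset.sum_const, nsmul_eq_mul]
            rw [hN]
            gcongr
            exact Finset.filter_subset _ _
    have := hS.trans (hJsum.le.trans (Finset.sum_le_sum hsplit))
    rw [Finset.sum_add_distrib] at this
    linarith
  -- the stem
  obtain ⟨u₀, hu₀, hstem⟩ : ∃ u₀ ∈ Ω, D / 2 / N ≤
      ∑ v ∈ G.filter (fun v => θ ≤ ‖u₀ - v‖ ∧ ‖u₀ - v‖ < 2 * θ),
        volume.real (E ∩ (T u₀ ∩ T v)) := by
    by_contra hcon
    push Not at hcon
    have hne : Ω.Nonempty := Finset.card_pos.1 (by rw [hN] at hNpos; exact_mod_cast hNpos)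
    have := Finset.sum_lt_sum_of_nonempty hne hcon
    rw [Finset.sum_const, nsmul_eq_mul, mul_div_cancel₀ _ hNpos.ne'] at this
    linarith
  set H := (G.filter (fun v => θ ≤ ‖u₀ - v‖ ∧ ‖u₀ - v‖ < 2 * θ)).filter
    fun v => (T v ∩ T u₀).Nonempty with hH
  have hHΩ : ∀ v ∈ H, v ∈ Ω := fun v hv =>
    (Finset.mem_filter.1 (Finset.mem_filter.1 (Finset.mem_filter.1 hv).1).1).1
  have hHθ : ∀ v ∈ H, θ ≤ ‖u₀ - v‖ := fun v hv =>
    (Finset.mem_filter.1 (Finset.mem_filter.1 hv).1).2.1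
  have hHne : ∀ v ∈ H, u₀ ≠ v := by
    rintro v hv rfl
    have := hHθ _ hv
    rw [sub_self, norm_zero] at this
    linarith
  have hHcard : D / 2 / N ≤ H.card * (4 ^ d * 4 * δ ^ d / θ) := by
    refine hstem.trans ?_
    rw [← Finset.sum_filter_add_sum_filter_not _ (fun v => (T v ∩ T u₀).Nonempty)]
    rw [Finset.sum_eq_zero (s := Finset.filter (fun v => ¬ (T v ∩ T u₀).Nonempty) _), add_zero,
      ← nsmul_eq_mul]
    · refine Finset.sum_le_card_nsmul _ _ _ fun v hv => ?_
      refine (measureReal_mono Set.inter_subset_right (measure_ne_top_of_subset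
        Set.inter_subset_left (hTfin u₀ hu₀))).trans
        ((volume_real_kakeyaTube_inter_le hd0 hδ (hΩ u₀ hu₀) (hΩ v (hHΩ v hv)) (hHne v hv)
          (hdiam _ hu₀ _ (hHΩ v hv)) _ _).trans ?_)
      gcongr
      exact hHθ v hv
    · intro v hv
      rw [Set.inter_comm (T u₀), Set.not_nonempty_iff_eq_empty.1 (Finset.mem_filter.1 hv).2]
      simp
  have hbr := hbrush hδ hlpos hl1 hK1 hK (ω₀ := u₀) (a₀ := a u₀) a (hΩ u₀ hu₀) H
    (fun u hu => hΩ u (hHΩ u hu)) (fun u hu => (hHne u hu).symm)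
    (fun u hu => hdiam u (hHΩ u hu) _ hu₀)
    (fun u hu v hv => hdiam u (hHΩ u hu) v (hHΩ v hv))
    (fun u hu v hv => hsep u (hHΩ u hu) v (hHΩ v hv))
    (fun u hu => (Finset.mem_filter.1 hu).2) E hE hE'
    (fun u hu => (Finset.mem_filter.1 (Finset.mem_filter.1 (Finset.mem_filter.1 hu).1).1).2)
  have hδd : δ ^ d = δ * δ ^ (d - 1) := by
    conv_lhs => rw [← Nat.sub_add_cancel hd0, pow_succ']
  -- combine the two bounds for the number of bristles
  have h1 : (c * l ^ d * δ ^ (d - 1)) * (D / 2 / N) ≤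
      K * X * (4 ^ d * 4 * (δ * δ ^ (d - 1)) / θ) := by
    rw [← hδd]
    refine (mul_le_mul_of_nonneg_left hHcard (by positivity)).trans ?_
    rw [← mul_assoc]
    exact mul_le_mul_of_nonneg_right hbr (by positivity)
  exact le_of_bristle_bounds hc hXpos hθ0 hδ (by positivity) (by positivity) hNpos h1

end Cap

/-! ### Pigeonholing pairs into caps and dyadic angles -/

section Level

variable {d : ℕ}

/-- The power `(d ^ 2 - 2) / (d (d - 1))` of the number of tubes in the estimate for the
`L ^ ((d + 2) / d)` norm of their counting function. -/
noncomputable def tubeExponent (d : ℕ) : ℝ := ((d : ℝ) ^ 2 - 2) / (d * (d - 1))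

lemma one_le_tubeExponent (hd : 2 ≤ d) : 1 ≤ tubeExponent d := by
  have : (2 : ℝ) ≤ d := by exact_mod_cast hd
  rw [tubeExponent, le_div_iff₀ (by nlinarith)]
  nlinarith

/-- The pair estimate for a family of tubes with directions in a cap of radius `3 * θ`, where the
number of tubes is controlled by `θ / δ`. -/
lemma exists_cap_const (hd : 2 ≤ d) (c₀ : ℝ) (hc₀ : 0 < c₀) : ∃ C : ℝ, 0 < C ∧
    ∀ {δ θ μ : ℝ}, 0 < δ → δ ≤ θ → 0 < μ → ∀ {K : ℕ}, 1 ≤ K → 1 ≤ 2 ^ K * δ →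
    ∀ (a : EuclideanSpace ℝ (Fin d) → EuclideanSpace ℝ (Fin d))
    (Ω : Finset (EuclideanSpace ℝ (Fin d))), (∀ u ∈ Ω, ‖u‖ = 1) →
    (∀ u ∈ Ω, ∀ v ∈ Ω, ‖u - v‖ ≤ 1 / 4) →
    (∀ u ∈ Ω, ∀ v ∈ Ω, u ≠ v → δ ≤ ‖u - v‖) →
    ∀ e : EuclideanSpace ℝ (Fin d), (∀ u ∈ Ω, ‖u - e‖ ≤ 3 * θ) →
    ∀ E : Set (EuclideanSpace ℝ (Fin d)), MeasurableSet E → volume E ≠ ∞ →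
    (∀ x ∈ E, (tubeCount δ a Ω x : ℝ) ≤ 2 * μ) →
    (∀ x ∈ E, (1 / (c₀ * K)) ^ 2 * μ ^ 2 ≤ pairCount δ θ a Ω x) →
    volume.real E * μ ^ (((d : ℝ) + 2) / d) ≤
      C * K ^ 4 * δ ^ (d - 1) * (Ω.card : ℝ) ^ tubeExponent d := by
  have hd0 : 0 < d := by omega
  obtain ⟨C, hC, hpairs⟩ := exists_pair_const hd
  set C₁ : ℝ := C * c₀ ^ (2 * d + 2) * (30 * d) with hC₁
  refine ⟨1 + C₁, by positivity, ?_⟩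
  intro δ θ μ hδ hθ hμ K hK1 hK a Ω hΩ hdiam hsep e he E hE hE' hmult hpair
  have hd2 : (2 : ℝ) ≤ d := by exact_mod_cast hd
  have hθ0 : 0 < θ := hδ.trans_le hθ
  have hK0 : (1 : ℝ) ≤ K := by exact_mod_cast hK1
  have hKpos : (0 : ℝ) < K := by linarith
  have h1 := hpairs hδ hθ hμ (b := 1 / (c₀ * K)) (by positivity) hK1 hK a Ω hΩ hdiam hsep E hE hE'
    hmult hpair
  rcases Ω.eq_empty_or_nonempty with hem | ⟨u₀, hu₀⟩
  · have hE0 : E = ∅ := by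
      by_contra hne
      obtain ⟨x, hx⟩ := Set.nonempty_iff_ne_empty.2 hne
      have := hpair x hx
      rw [hem] at this
      have h2 : 0 < (1 / (c₀ * K)) ^ 2 * μ ^ 2 := by positivity
      simp [pairCount] at this
      simp at h2
      linarith
    rw [hE0]
    simp only [measureReal_empty, zero_mul]
    positivity
  have hN : (0 : ℝ) < Ω.card := by exact_mod_cast Finset.card_pos.2 ⟨u₀, hu₀⟩
  set N : ℝ := (Ω.card : ℝ) with hNdef
  set X := volume.real E with hX
  have hX0 : 0 ≤ X := measureReal_nonneg
  set n : ℝ := N ^ (1 / ((d : ℝ) - 1)) with hn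
  have hnpos : 0 < n := Real.rpow_pos_of_pos hN _
  have hpack : N ≤ (30 * d * θ / δ) ^ (d - 1) := by
    have := card_le_pow_of_separated hd0 hδ (R := 3 * θ) (by linarith) Ω (hΩ u₀ hu₀) hΩ
      (fun u hu => hdiam u hu u₀ hu₀) hsep he
    refine this.trans (le_of_eq ?_)
    congr 2; ring
  have hnle : n ≤ 30 * d * θ / δ := by
    have hcast : ((d : ℝ) - 1) = ((d - 1 : ℕ) : ℝ) := by rw [Nat.cast_sub (by omega)]; simp
    rw [hn, one_div, Real.rpow_inv_le_iff_of_pos hN.le (by positivity) (by linarith), hcast,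
      Real.rpow_natCast]
    exact hpack
  have hNs : (N ^ tubeExponent d) ^ d = N ^ (d + 1) / n := by
    rw [hn, ← Real.rpow_natCast N (d + 1), ← Real.rpow_sub hN, ← Real.rpow_natCast,
      ← Real.rpow_mul hN.le]
    congr 1
    have : (d : ℝ) - 1 ≠ 0 := by linarith
    have : (d : ℝ) ≠ 0 := by linarith
    rw [tubeExponent]
    push_cast
    field_simp
    ring
  have hμd : (μ ^ (((d : ℝ) + 2) / d)) ^ d = μ ^ (d + 2) := by
    rw [← Real.rpow_natCast, ← Real.rpow_mul hμ.le, ← Real.rpow_natCast μ (d + 2)]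
    congr 1
    push_cast
    field_simp
  refine le_of_pow_le_pow_left₀ hd0.ne' (by positivity) ?_
  set P := δ ^ (d - 1) with hP
  have hPpos : 0 < P := by positivity
  have h2 : X ^ d * μ ^ (d + 2) ≤
      C * K * N ^ (d + 1) * P ^ d * ((c₀ * K) ^ (2 * d + 2) * (30 * d / n)) := by
    have h3 : (1 : ℝ) ≤ θ / δ * (30 * d / n) := by
      have : θ / δ * (30 * d / n) = (30 * d * θ / δ) / n := by field_simp
      rw [this, le_div_iff₀ hnpos]; linarith
    calc X ^ d * μ ^ (d + 2) ≤ X ^ d * μ ^ (d + 2) * (θ / δ * (30 * d / n)) :=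
          le_mul_of_one_le_right (by positivity) h3
      _ = (X ^ d * μ ^ (d + 2) * (1 / (c₀ * K)) ^ (2 * d + 2) * (θ / δ)) *
          ((c₀ * K) ^ (2 * d + 2) * (30 * d / n)) := by
          rw [one_div_pow]; field_simp
      _ ≤ _ := mul_le_mul_of_nonneg_right h1 (by positivity)
  rw [mul_pow, hμd, mul_pow, mul_pow, mul_pow, hNs]
  refine h2.trans ?_
  have h4 : C * K * N ^ (d + 1) * P ^ d * ((c₀ * K) ^ (2 * d + 2) * (30 * d / n)) =
      C₁ * (K : ℝ) ^ (2 * d + 3) * P ^ d * (N ^ (d + 1) / n) := by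
    rw [hC₁, mul_pow, pow_succ (K : ℝ) (2 * d + 2)]; field_simp
  have h5 : C₁ ≤ (1 + C₁) ^ d := by
    have : 0 < C₁ := by positivity
    calc C₁ ≤ 1 + C₁ := by linarith
      _ ≤ _ := le_self_pow₀ (by linarith) hd0.ne'
  have h6 : (K : ℝ) ^ (2 * d + 3) ≤ ((K : ℝ) ^ 4) ^ d := by
    rw [← pow_mul]; exact pow_le_pow_right₀ hK0 (by omega)
  rw [h4]
  gcongr

lemma exists_maximal_separated {E : Type*} [NormedAddCommGroup E] (Ω : Finset E) (θ : ℝ)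
    (hθ : 0 < θ) : ∃ D ⊆ Ω, (∀ u ∈ D, ∀ v ∈ D, u ≠ v → θ ≤ ‖u - v‖) ∧
      ∀ u ∈ Ω, ∃ v ∈ D, ‖u - v‖ < θ := by
  classical
  obtain ⟨D, hD, hmax⟩ := Finset.exists_max_image
    (Ω.powerset.filter fun D => ∀ u ∈ D, ∀ v ∈ D, u ≠ v → θ ≤ ‖u - v‖) Finset.card
    ⟨∅, by simp⟩
  obtain ⟨hDΩ, hDs⟩ := Finset.mem_filter.1 hD
  rw [Finset.mem_powerset] at hDΩ
  refine ⟨D, hDΩ, hDs, fun u hu => ?_⟩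
  by_contra! hcon
  have huD : u ∉ D := fun h => by have := hcon u h; simp at this; linarith
  have := hmax (insert u D) (by
    refine Finset.mem_filter.2 ⟨Finset.mem_powerset.2 (Finset.insert_subset hu hDΩ), ?_⟩
    intro v hv w hw hvw
    rcases Finset.mem_insert.1 hv with rfl | hv' <;> rcases Finset.mem_insert.1 hw with rfl | hw'
    · exact absurd rfl hvw
    · exact hcon w hw'
    · rw [norm_sub_rev]; exact hcon v hv'
    · exact hDs v hv' w hw' hvw)
  rw [Finset.card_insert_of_notMem huD] at this
  omega

open Classical in
lemma pairCount_eq_card (δ θ : ℝ) (a : EuclideanSpace ℝ (Fin d) → EuclideanSpace ℝ (Fin d))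
    (Ω : Finset (EuclideanSpace ℝ (Fin d))) (x : EuclideanSpace ℝ (Fin d)) :
    pairCount δ θ a Ω x = (((Ω.filter fun u => x ∈ kakeyaTube δ u (a u)) ×ˢ
      (Ω.filter fun u => x ∈ kakeyaTube δ u (a u))).filter
        fun p => θ ≤ ‖p.1 - p.2‖ ∧ ‖p.1 - p.2‖ < 2 * θ).card := by
  unfold pairCount
  congr 1
  ext p
  simp only [Finset.mem_filter, Finset.mem_product, Set.mem_inter_iff]
  tauto

lemma pairCount_le_sq (δ θ : ℝ) (a : EuclideanSpace ℝ (Fin d) → EuclideanSpace ℝ (Fin d))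
    (Ω : Finset (EuclideanSpace ℝ (Fin d))) (x : EuclideanSpace ℝ (Fin d)) :
    pairCount δ θ a Ω x ≤ tubeCount δ a Ω x ^ 2 := by
  rw [pairCount_eq_card, sq, tubeCount, ← Finset.card_product]
  exact Finset.card_filter_le _ _

/-- Every ordered pair of tubes through `x` is diagonal or lies in one of the dyadic rings. -/
lemma tubeCount_sq_le {δ : ℝ} {K : ℕ} (hK : 1 ≤ 2 ^ K * δ)
    (a : EuclideanSpace ℝ (Fin d) → EuclideanSpace ℝ (Fin d))
    (Ω : Finset (EuclideanSpace ℝ (Fin d))) (hdiam : ∀ u ∈ Ω, ∀ v ∈ Ω, ‖u - v‖ ≤ 1 / 4)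
    (hsep : ∀ u ∈ Ω, ∀ v ∈ Ω, u ≠ v → δ ≤ ‖u - v‖) (x : EuclideanSpace ℝ (Fin d)) :
    tubeCount δ a Ω x ^ 2 ≤
      tubeCount δ a Ω x + ∑ k ∈ Finset.range K, pairCount δ (2 ^ k * δ) a Ω x := by
  classical
  simp_rw [pairCount_eq_card]
  rw [sq, tubeCount, ← Finset.card_product]
  set S := Ω.filter fun u => x ∈ kakeyaTube δ u (a u) with hS
  have hsub : S ×ˢ S ⊆ S.diag ∪ (Finset.range K).biUnion fun k => (S ×ˢ S).filter
      fun p => 2 ^ k * δ ≤ ‖p.1 - p.2‖ ∧ ‖p.1 - p.2‖ < 2 * (2 ^ k * δ) := by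
    intro p hp
    obtain ⟨h1, h2⟩ := Finset.mem_product.1 hp
    by_cases h : p.1 = p.2
    · exact Finset.mem_union_left _ (Finset.mem_diag.2 ⟨h1, h⟩)
    · refine Finset.mem_union_right _ (Finset.mem_biUnion.2 ?_)
      have m1 := (Finset.mem_filter.1 h1).1
      have m2 := (Finset.mem_filter.1 h2).1
      obtain ⟨k, hk, h3, h4⟩ := exists_ring hK (hsep _ m1 _ m2 h) (hdiam _ m1 _ m2)
      refine ⟨k, hk, Finset.mem_filter.2 ⟨hp, h3, ?_⟩⟩
      rw [pow_succ] at h4; linarith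
  refine (Finset.card_le_card hsub).trans ((Finset.card_union_le _ _).trans ?_)
  rw [Finset.diag_card]
  gcongr
  exact Finset.card_biUnion_le

open Classical in
lemma pairCount_le_sum {δ θ : ℝ} (a : EuclideanSpace ℝ (Fin d) → EuclideanSpace ℝ (Fin d))
    (Ω D : Finset (EuclideanSpace ℝ (Fin d)))
    (hD : ∀ u ∈ Ω, ∃ v ∈ D, ‖u - v‖ < θ) (x : EuclideanSpace ℝ (Fin d)) :
    pairCount δ θ a Ω x ≤
      ∑ e ∈ D, pairCount δ θ a (Ω.filter fun u => ‖u - e‖ ≤ 3 * θ) x := by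
  simp_rw [pairCount_eq_card]
  refine le_trans (Finset.card_le_card ?_) Finset.card_biUnion_le
  intro p hp
  simp only [Finset.mem_filter, Finset.mem_product, Finset.mem_biUnion] at hp ⊢
  obtain ⟨⟨⟨h1, h1'⟩, h2, h2'⟩, h3, h4⟩ := hp
  obtain ⟨e, he, heθ⟩ := hD _ h1
  refine ⟨e, he, ⟨⟨⟨h1, ?_⟩, h1'⟩, ⟨h2, ?_⟩, h2'⟩, h3, h4⟩
  · linarith [norm_nonneg (p.1 - p.2)]
  · have : p.2 - e = (p.1 - e) - (p.1 - p.2) := by abel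
    rw [this]
    exact (norm_sub_le _ _).trans (by linarith)

open Classical in
lemma sum_card_filter_close_le (hd : 0 < d) {θ : ℝ} (hθ : 0 < θ)
    (S D : Finset (EuclideanSpace ℝ (Fin d)))
    (hS : ∀ u ∈ S, ‖u‖ = 1) (hD : ∀ u ∈ D, ‖u‖ = 1)
    (hdiam : ∀ u ∈ S, ∀ v ∈ D, ‖u - v‖ ≤ 1 / 4)
    (hsep : ∀ u ∈ D, ∀ v ∈ D, u ≠ v → θ ≤ ‖u - v‖) :
    ∑ e ∈ D, ((S.filter fun u => ‖u - e‖ ≤ 3 * θ).card : ℝ) ≤ (30 * d) ^ (d - 1) * S.card := by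
  have h1 : ∑ e ∈ D, ((S.filter fun u => ‖u - e‖ ≤ 3 * θ).card : ℝ) =
      ∑ u ∈ S, ((D.filter fun e => ‖u - e‖ ≤ 3 * θ).card : ℝ) := by
    simp_rw [Finset.card_filter, Nat.cast_sum]
    exact Finset.sum_comm
  rw [h1, mul_comm (((30 : ℝ) * d) ^ (d - 1)), ← nsmul_eq_mul]
  refine Finset.sum_le_card_nsmul _ _ _ fun u hu => ?_
  refine (card_le_pow_of_separated hd hθ (R := 3 * θ) (by linarith) _ (hS u hu) (c := u)
    (fun v hv => hD v (Finset.mem_filter.1 hv).1)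
    (fun v hv => by rw [norm_sub_rev]; exact hdiam u hu v (Finset.mem_filter.1 hv).1)
    (fun v hv w hw => hsep v (Finset.mem_filter.1 hv).1 w (Finset.mem_filter.1 hw).1)
    (fun v hv => by rw [norm_sub_rev]; exact (Finset.mem_filter.1 hv).2)).trans (le_of_eq ?_)
  congr 1
  field_simp
  ring

open Classical in
/-- At a point with at least two tubes, a proportion of the pairs of tubes lies in a single cap and
in a single dyadic range of angles, up to logarithmic factors. -/
lemma exists_le_pairCount (hd : 0 < d) {δ μ : ℝ} (hδ : 0 < δ) (hμ : 2 ≤ μ) {K : ℕ} (hK1 : 1 ≤ K)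
    (hK : 1 ≤ 2 ^ K * δ) (a : EuclideanSpace ℝ (Fin d) → EuclideanSpace ℝ (Fin d))
    (Ω : Finset (EuclideanSpace ℝ (Fin d))) (hΩ : ∀ u ∈ Ω, ‖u‖ = 1)
    (hdiam : ∀ u ∈ Ω, ∀ v ∈ Ω, ‖u - v‖ ≤ 1 / 4)
    (hsep : ∀ u ∈ Ω, ∀ v ∈ Ω, u ≠ v → δ ≤ ‖u - v‖)
    (D : ℕ → Finset (EuclideanSpace ℝ (Fin d))) (hDΩ : ∀ k, D k ⊆ Ω)
    (hDsep : ∀ k, ∀ u ∈ D k, ∀ v ∈ D k, u ≠ v → 2 ^ k * δ ≤ ‖u - v‖)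
    (hDmax : ∀ k, ∀ u ∈ Ω, ∃ v ∈ D k, ‖u - v‖ < 2 ^ k * δ)
    (x : EuclideanSpace ℝ (Fin d)) (hx : μ ≤ tubeCount δ a Ω x) :
    ∃ k ∈ Finset.range K, ∃ e ∈ D k, (1 / (4 * (30 * d) ^ (d - 1) * K)) ^ 2 * μ ^ 2 ≤
      pairCount δ (2 ^ k * δ) a (Ω.filter fun u => ‖u - e‖ ≤ 3 * (2 ^ k * δ)) x := by
  by_contra! hcon
  have hK0 : (0 : ℝ) < K := by exact_mod_cast hK1
  set b : ℝ := 1 / (4 * (30 * d) ^ (d - 1) * K) with hb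
  have hbpos : 0 < b := by positivity
  set m : ℝ := (tubeCount δ a Ω x : ℝ) with hm
  have h1 : ∀ k ∈ Finset.range K,
      (pairCount δ (2 ^ k * δ) a Ω x : ℝ) ≤ b * μ * ((30 * d) ^ (d - 1) * m) := by
    intro k hk
    have h2 : ∀ e ∈ D k,
        (pairCount δ (2 ^ k * δ) a (Ω.filter fun u => ‖u - e‖ ≤ 3 * (2 ^ k * δ)) x : ℝ) ≤
          b * μ * tubeCount δ a (Ω.filter fun u => ‖u - e‖ ≤ 3 * (2 ^ k * δ)) x := by
      intro e he
      have h3 := hcon k hk e he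
      have h4 : (pairCount δ (2 ^ k * δ) a (Ω.filter fun u => ‖u - e‖ ≤ 3 * (2 ^ k * δ)) x : ℝ) ≤
          (tubeCount δ a (Ω.filter fun u => ‖u - e‖ ≤ 3 * (2 ^ k * δ)) x : ℝ) ^ 2 := by
        exact_mod_cast pairCount_le_sq _ _ _ _ _
      set y : ℝ := (tubeCount δ a (Ω.filter fun u => ‖u - e‖ ≤ 3 * (2 ^ k * δ)) x : ℝ)
      have hy : 0 ≤ y := Nat.cast_nonneg _
      have hbμ : 0 < b * μ := by positivity
      rcases le_total y (b * μ) with h | h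
      · nlinarith
      · nlinarith
    have h5 : (pairCount δ (2 ^ k * δ) a Ω x : ℝ) ≤ ∑ e ∈ D k,
        (pairCount δ (2 ^ k * δ) a (Ω.filter fun u => ‖u - e‖ ≤ 3 * (2 ^ k * δ)) x : ℝ) := by
      exact_mod_cast pairCount_le_sum a Ω (D k) (hDmax k) x
    refine h5.trans ((Finset.sum_le_sum h2).trans ?_)
    rw [← Finset.mul_sum]
    refine mul_le_mul_of_nonneg_left ?_ (by positivity)
    have h6 := sum_card_filter_close_le hd (θ := 2 ^ k * δ) (by positivity)
      (Ω.filter fun u => x ∈ kakeyaTube δ u (a u)) (D k)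
      (fun u hu => hΩ u (Finset.mem_filter.1 hu).1) (fun u hu => hΩ u (hDΩ k hu))
      (fun u hu v hv => hdiam u (Finset.mem_filter.1 hu).1 v (hDΩ k hv)) (hDsep k)
    refine le_trans (le_of_eq (Finset.sum_congr rfl fun e _ => ?_)) h6
    rw [tubeCount, Finset.filter_comm]
  have h7 : m ^ 2 ≤ m + ∑ k ∈ Finset.range K, (pairCount δ (2 ^ k * δ) a Ω x : ℝ) := by
    rw [hm]; exact_mod_cast tubeCount_sq_le hK a Ω hdiam hsep x
  have h8 := Finset.sum_le_card_nsmul _ _ _ h1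
  rw [Finset.card_range, nsmul_eq_mul] at h8
  have h9 : K * (b * μ * ((30 * d) ^ (d - 1) * m)) = μ * m / 4 := by
    rw [hb]; field_simp
  rw [h9] at h8
  nlinarith

lemma measurable_pairCount (δ θ : ℝ)
    (a : EuclideanSpace ℝ (Fin d) → EuclideanSpace ℝ (Fin d))
    (Ω : Finset (EuclideanSpace ℝ (Fin d))) :
    Measurable fun x => (pairCount δ θ a Ω x : ℝ) := by
  classical
  have := funext (sum_indicator_one_eq_card
    ((Ω ×ˢ Ω).filter fun p => θ ≤ ‖p.1 - p.2‖ ∧ ‖p.1 - p.2‖ < 2 * θ)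
    fun p => kakeyaTube δ p.1 (a p.1) ∩ kakeyaTube δ p.2 (a p.2))
  have heq : (fun x => (pairCount δ θ a Ω x : ℝ)) = _ := Eq.trans (by
    funext x; unfold pairCount; congr!) this.symm
  rw [heq]
  exact Finset.measurable_sum _ fun p _ => measurable_const.indicator
    ((measurableSet_kakeyaTube _ _ _).inter (measurableSet_kakeyaTube _ _ _))

lemma measurable_tubeCount (δ : ℝ)
    (a : EuclideanSpace ℝ (Fin d) → EuclideanSpace ℝ (Fin d))
    (Ω : Finset (EuclideanSpace ℝ (Fin d))) :
    Measurable fun x => (tubeCount δ a Ω x : ℝ) := by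
  classical
  have := funext (sum_indicator_one_eq_card Ω fun u => kakeyaTube δ u (a u))
  refine Eq.subst this (motive := Measurable) ?_
  exact Finset.measurable_sum _ fun p _ => measurable_const.indicator
    (measurableSet_kakeyaTube _ _ _)

end Level

/-! ### The counting function of a family of tubes -/

section Norm

variable {d : ℕ}

/-- The volume of the set where the counting function is about `μ`, summing the estimates for single
caps over all caps and dyadic angles. -/
lemma exists_level_const (hd : 2 ≤ d) : ∃ C : ℝ, 0 < C ∧
    ∀ {δ μ : ℝ}, 0 < δ → 2 ≤ μ → ∀ {K : ℕ}, 1 ≤ K → 1 ≤ 2 ^ K * δ →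
    ∀ (a : EuclideanSpace ℝ (Fin d) → EuclideanSpace ℝ (Fin d))
    (Ω : Finset (EuclideanSpace ℝ (Fin d))), (∀ u ∈ Ω, ‖u‖ = 1) →
    (∀ u ∈ Ω, ∀ v ∈ Ω, ‖u - v‖ ≤ 1 / 4) →
    (∀ u ∈ Ω, ∀ v ∈ Ω, u ≠ v → δ ≤ ‖u - v‖) →
    ∀ E : Set (EuclideanSpace ℝ (Fin d)), MeasurableSet E → volume E ≠ ∞ →
    (∀ x ∈ E, μ ≤ tubeCount δ a Ω x ∧ (tubeCount δ a Ω x : ℝ) ≤ 2 * μ) →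
    volume.real E * μ ^ (((d : ℝ) + 2) / d) ≤
      C * K ^ 5 * δ ^ (d - 1) * (Ω.card : ℝ) ^ tubeExponent d := by
  classical
  have hd0 : 0 < d := by omega
  obtain ⟨C, hC, hcap⟩ := exists_cap_const hd (4 * (30 * d) ^ (d - 1)) (by positivity)
  refine ⟨C * (30 * d) ^ (d - 1), by positivity, ?_⟩
  intro δ μ hδ hμ K hK1 hK a Ω hΩ hdiam hsep E hE hE' hlevel
  have hK0 : (0 : ℝ) < K := by exact_mod_cast hK1
  choose D hDΩ hDsep hDmax using fun k : ℕ =>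
    exists_maximal_separated Ω (2 ^ k * δ) (by positivity)
  set cap : ℕ → EuclideanSpace ℝ (Fin d) → Finset (EuclideanSpace ℝ (Fin d)) :=
    fun k e => Ω.filter fun u => ‖u - e‖ ≤ 3 * (2 ^ k * δ) with hcapdef
  set F : ℕ → EuclideanSpace ℝ (Fin d) → Set (EuclideanSpace ℝ (Fin d)) := fun k e =>
    E ∩ {x | (1 / (4 * (30 * d) ^ (d - 1) * K)) ^ 2 * μ ^ 2 ≤
      (pairCount δ (2 ^ k * δ) a (cap k e) x : ℝ)} with hF
  have hFm : ∀ k e, MeasurableSet (F k e) := fun k e =>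
    hE.inter (measurableSet_le measurable_const (measurable_pairCount _ _ _ _))
  have hcover : E ⊆ ⋃ k ∈ Finset.range K, ⋃ e ∈ D k, F k e := by
    intro x hx
    obtain ⟨k, hk, e, he, h⟩ := exists_le_pairCount hd0 hδ hμ hK1 hK a Ω hΩ hdiam hsep D hDΩ
      hDsep hDmax x (hlevel x hx).1
    simp only [Set.mem_iUnion]
    exact ⟨k, hk, e, he, hx, h⟩
  have hFfin : ∀ k e, volume (F k e) ≠ ∞ := fun k e =>
    measure_ne_top_of_subset Set.inter_subset_left hE'
  have hvol : volume.real E ≤ ∑ k ∈ Finset.range K, ∑ e ∈ D k, volume.real (F k e) := by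
    refine (measureReal_mono hcover (measure_ne_top_of_subset ?_ hE')).trans ?_
    · simp only [Set.iUnion_subset_iff]
      exact fun _ _ _ _ => Set.inter_subset_left
    · refine (measureReal_biUnion_finset_le _ _).trans (Finset.sum_le_sum fun k _ => ?_)
      exact measureReal_biUnion_finset_le _ _
  set N : ℝ := (Ω.card : ℝ) with hN
  have hs := one_le_tubeExponent hd
  have hcapN : ∀ k e, (((cap k e).card : ℝ)) ^ tubeExponent d ≤
      N ^ (tubeExponent d - 1) * (cap k e).card := by
    intro k e
    have hle : ((cap k e).card : ℝ) ≤ N := by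
      rw [hN]; exact_mod_cast Finset.card_filter_le _ _
    rcases (Nat.cast_nonneg (α := ℝ) (cap k e).card).eq_or_lt with h | h
    · rw [← h, Real.zero_rpow (by linarith), mul_zero]
    · calc _ = ((cap k e).card : ℝ) ^ (tubeExponent d - 1) * (cap k e).card := by
            rw [Real.rpow_sub_one h.ne']; field_simp
        _ ≤ _ := by
            gcongr
  have hNN : N ^ (tubeExponent d - 1) * N = N ^ tubeExponent d := by
    rcases (Nat.cast_nonneg (α := ℝ) Ω.card).eq_or_lt with h | h
    · rw [hN, ← h, Real.zero_rpow (x := tubeExponent d) (by linarith), mul_zero]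
    · rw [hN, Real.rpow_sub_one h.ne']; field_simp
  have hrow : ∀ k ∈ Finset.range K,
      (∑ e ∈ D k, volume.real (F k e)) * μ ^ (((d : ℝ) + 2) / d) ≤
        C * K ^ 4 * δ ^ (d - 1) * ((30 * d) ^ (d - 1) * N ^ tubeExponent d) := by
    intro k _
    rw [Finset.sum_mul]
    have h2k : (1 : ℝ) ≤ 2 ^ k := one_le_pow₀ (by norm_num)
    calc _ ≤ ∑ e ∈ D k, C * K ^ 4 * δ ^ (d - 1) *
            (N ^ (tubeExponent d - 1) * (cap k e).card) := by
          refine Finset.sum_le_sum fun e _ => ?_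
          refine (hcap hδ (θ := 2 ^ k * δ) (by nlinarith) (by linarith) hK1 hK a (cap k e)
            (fun u hu => hΩ u (Finset.mem_filter.1 hu).1)
            (fun u hu v hv => hdiam u (Finset.mem_filter.1 hu).1 v (Finset.mem_filter.1 hv).1)
            (fun u hu v hv => hsep u (Finset.mem_filter.1 hu).1 v (Finset.mem_filter.1 hv).1)
            e (fun u hu => (Finset.mem_filter.1 hu).2) (F k e) (hFm k e) (hFfin k e)
            (fun x hx => le_trans ?_ (hlevel x hx.1).2) (fun x hx => hx.2)).trans
            (mul_le_mul_of_nonneg_left (hcapN k e) (by positivity))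
          unfold tubeCount
          exact_mod_cast Finset.card_le_card
            (Finset.filter_subset_filter _ (Finset.filter_subset _ _))
      _ = C * K ^ 4 * δ ^ (d - 1) *
            (N ^ (tubeExponent d - 1) * ∑ e ∈ D k, ((cap k e).card : ℝ)) := by
          rw [Finset.mul_sum, Finset.mul_sum]
      _ ≤ C * K ^ 4 * δ ^ (d - 1) *
            (N ^ (tubeExponent d - 1) * ((30 * d) ^ (d - 1) * N)) := by
          gcongr
          exact sum_card_filter_close_le hd0 (by positivity) Ω (D k) hΩ
            (fun u hu => hΩ u (hDΩ k hu)) (fun u hu v hv => hdiam u hu v (hDΩ k hv)) (hDsep k)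
      _ = _ := by rw [← hNN]; ring
  calc _ ≤ (∑ k ∈ Finset.range K, ∑ e ∈ D k, volume.real (F k e)) *
        μ ^ (((d : ℝ) + 2) / d) := by gcongr
    _ ≤ ∑ k ∈ Finset.range K,
        C * K ^ 4 * δ ^ (d - 1) * ((30 * d) ^ (d - 1) * N ^ tubeExponent d) := by
        rw [Finset.sum_mul]; exact Finset.sum_le_sum hrow
    _ = _ := by rw [Finset.sum_const, Finset.card_range, nsmul_eq_mul]; ring

lemma tubeCount_pos_iff (δ : ℝ) (a : EuclideanSpace ℝ (Fin d) → EuclideanSpace ℝ (Fin d))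
    (Ω : Finset (EuclideanSpace ℝ (Fin d))) (x : EuclideanSpace ℝ (Fin d)) :
    0 < tubeCount δ a Ω x ↔ ∃ u ∈ Ω, x ∈ kakeyaTube δ u (a u) := by
  classical
  simp [tubeCount, Finset.card_pos, Finset.Nonempty]

/-- The dual form of the maximal function estimate: the `L ^ ((d + 2) / d)` norm of the counting
function of tubes with `δ`-separated directions. -/
lemma exists_norm_const (hd : 2 ≤ d) : ∃ C : ℝ, 0 < C ∧
    ∀ {δ : ℝ}, 0 < δ → δ ≤ 1 → ∀ {K : ℕ}, 1 ≤ K → 1 ≤ 2 ^ K * δ →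
    ∀ (a : EuclideanSpace ℝ (Fin d) → EuclideanSpace ℝ (Fin d))
    (Ω : Finset (EuclideanSpace ℝ (Fin d))), (∀ u ∈ Ω, ‖u‖ = 1) →
    (∀ u ∈ Ω, ∀ v ∈ Ω, ‖u - v‖ ≤ 1 / 4) →
    (∀ u ∈ Ω, ∀ v ∈ Ω, u ≠ v → δ ≤ ‖u - v‖) →
    ∫⁻ x, (tubeCount δ a Ω x : ℝ≥0∞) ^ (((d : ℝ) + 2) / d) ≤
      ENNReal.ofReal (C * K ^ 6 * δ ^ (d - 1) * (Ω.card : ℝ) ^ tubeExponent d) := by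
  classical
  have hd0 : 0 < d := by omega
  obtain ⟨C, hC, hlev⟩ := exists_level_const hd
  set p : ℝ := ((d : ℝ) + 2) / d with hp
  have hp0 : 0 < p := by positivity
  have h2p : (0 : ℝ) < 2 ^ p := by positivity
  refine ⟨2 ^ d + 12 * d ^ 2 * (2 ^ p * C), by positivity, ?_⟩
  intro δ hδ hδ1 K hK1 hK a Ω hΩ hdiam hsep
  have hKR : (1 : ℝ) ≤ K := by exact_mod_cast hK1
  set N : ℝ := (Ω.card : ℝ) with hN
  set m := tubeCount δ a Ω with hm
  have hmm : Measurable fun x => (m x : ℝ) := measurable_tubeCount δ a Ω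
  set J : ℕ := (10 * d + K) * (d - 1) with hJ
  have hNJ : N ≤ 2 ^ J := by
    rcases Ω.eq_empty_or_nonempty with h | ⟨u₀, hu₀⟩
    · rw [hN, h]; simp
    have h1 := card_le_pow_of_separated hd0 hδ hδ1 Ω (hΩ u₀ hu₀) hΩ
      (fun u hu => hdiam u hu u₀ hu₀) hsep (c := u₀)
      (fun u hu => (hdiam u hu u₀ hu₀).trans (by norm_num))
    refine h1.trans ?_
    rw [hJ, pow_mul]
    refine pow_le_pow_left₀ (by positivity) ?_ _
    have h2 : (10 * d : ℝ) ≤ 2 ^ (10 * d) := by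
      have := (Nat.lt_two_pow_self (n := 10 * d)).le
      exact_mod_cast this
    rw [pow_add, mul_one, div_le_iff₀ hδ]
    calc (10 * d : ℝ) ≤ 2 ^ (10 * d) * 1 := by linarith
      _ ≤ 2 ^ (10 * d) * (2 ^ K * δ) := by gcongr
      _ = _ := by ring
  have hJK : (J : ℝ) ≤ 12 * d ^ 2 * K := by
    have h1 : J ≤ 12 * d ^ 2 * K := by
      rw [hJ]
      calc (10 * d + K) * (d - 1) ≤ (10 * d * K + 2 * d * K) * d := by
            refine Nat.mul_le_mul (Nat.add_le_add ?_ ?_) (Nat.sub_le _ _)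
            · exact Nat.le_mul_of_pos_right _ hK1
            · exact Nat.le_mul_of_pos_left _ (by positivity)
        _ = _ := by ring
    exact_mod_cast h1
  -- all level sets lie in the union of the tubes
  have hunion : volume (⋃ u ∈ Ω, kakeyaTube δ u (a u)) ≤
      ENNReal.ofReal (N * (2 ^ d * δ ^ (d - 1))) := by
    refine (measure_biUnion_finset_le _ _).trans ?_
    refine (Finset.sum_le_card_nsmul _ _ _ fun u hu =>
      volume_kakeyaTube_le hd0 hδ (hΩ u hu) (a u)).trans (le_of_eq ?_)
    rw [nsmul_eq_mul, ENNReal.ofReal_mul (Nat.cast_nonneg _), ENNReal.ofReal_natCast]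
  have hsubU : ∀ x, 0 < m x → x ∈ ⋃ u ∈ Ω, kakeyaTube δ u (a u) := by
    intro x hx
    obtain ⟨u, hu, hxu⟩ := (tubeCount_pos_iff _ _ _ _).1 hx
    exact Set.mem_iUnion₂.2 ⟨u, hu, hxu⟩
  set E₀ : Set (EuclideanSpace ℝ (Fin d)) := {x | (m x : ℝ) = 1} with hE₀
  set E : ℕ → Set (EuclideanSpace ℝ (Fin d)) := fun j =>
    {x | (2 : ℝ) ^ (j + 1) ≤ m x ∧ (m x : ℝ) ≤ 2 * 2 ^ (j + 1)} with hEdef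
  have hE₀m : MeasurableSet E₀ := hmm (measurableSet_singleton 1)
  have hEm : ∀ j, MeasurableSet (E j) := fun j =>
    (measurableSet_le measurable_const hmm).inter (measurableSet_le hmm measurable_const)
  have hE₀sub : E₀ ⊆ ⋃ u ∈ Ω, kakeyaTube δ u (a u) := fun x hx => hsubU x (by
    have : (m x : ℝ) = 1 := hx
    have : m x = 1 := by exact_mod_cast this
    omega)
  have hEsub : ∀ j, E j ⊆ ⋃ u ∈ Ω, kakeyaTube δ u (a u) := fun j x hx => hsubU x (by
    have h1 : (2 : ℝ) ^ (j + 1) ≤ m x := hx.1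
    have h2 : (0 : ℝ) < 2 ^ (j + 1) := by positivity
    exact_mod_cast h2.trans_le h1)
  have hEfin : ∀ j, volume (E j) ≠ ∞ := fun j =>
    ((measure_mono (hEsub j)).trans_lt (hunion.trans_lt ENNReal.ofReal_lt_top)).ne
  have hpoint : ∀ x, (m x : ℝ≥0∞) ^ p ≤ E₀.indicator (fun _ => 1) x +
      ∑ j ∈ Finset.range J,
        (E j).indicator (fun _ => ENNReal.ofReal ((2 * 2 ^ (j + 1)) ^ p)) x := by
    intro x
    rcases Nat.eq_zero_or_pos (m x) with h0 | hpos
    · rw [h0, Nat.cast_zero, ENNReal.zero_rpow_of_pos hp0]; exact zero_le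
    by_cases h1 : m x = 1
    · have hx : x ∈ E₀ := by simp [hE₀, h1]
      rw [Set.indicator_of_mem hx, h1]
      simp
    · have h2 : 2 ≤ m x := by omega
      have h3 : 1 ≤ Nat.log 2 (m x) := Nat.log_pos (by norm_num) h2
      obtain ⟨j, hj⟩ : ∃ j, Nat.log 2 (m x) = j + 1 := ⟨_, (Nat.sub_add_cancel h3).symm⟩
      have h4 : 2 ^ (j + 1) ≤ m x := by rw [← hj]; exact Nat.pow_log_le_self 2 (by omega)
      have h5 : m x < 2 ^ (j + 2) := by
        have := Nat.lt_pow_succ_log_self (b := 2) (by norm_num) (m x)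
        rwa [hj] at this
      have h6 : (m x : ℝ) ≤ 2 * 2 ^ (j + 1) := by
        have : (m x : ℝ) < 2 ^ (j + 2) := by exact_mod_cast h5
        rw [pow_succ] at this; linarith
      have hx : x ∈ E j := ⟨by exact_mod_cast h4, h6⟩
      have hjJ : j ∈ Finset.range J := by
        have h7 : (m x : ℝ) ≤ N := by rw [hN]; exact_mod_cast Finset.card_filter_le _ _
        have h8 : (2 : ℝ) ^ (j + 1) ≤ 2 ^ J := (hx.1).trans (h7.trans hNJ)
        have := (pow_le_pow_iff_right₀ (by norm_num : (1 : ℝ) < 2)).1 h8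
        exact Finset.mem_range.2 (by omega)
      refine le_trans ?_ (le_add_left (Finset.single_le_sum (fun _ _ => zero_le) hjJ))
      rw [Set.indicator_of_mem hx, ← ENNReal.ofReal_rpow_of_nonneg (by positivity) hp0.le]
      gcongr
      rw [← ENNReal.ofReal_natCast]
      exact ENNReal.ofReal_le_ofReal h6
  have hN1 : N ≤ N ^ tubeExponent d := by
    rcases Nat.eq_zero_or_pos Ω.card with h | h
    · rw [hN, h, Nat.cast_zero, Real.zero_rpow (by linarith [one_le_tubeExponent hd])]
    · exact Real.self_le_rpow_of_one_le (by rw [hN]; exact_mod_cast h) (one_le_tubeExponent hd)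
  have hN0 : 0 ≤ N ^ tubeExponent d := by positivity
  calc _ ≤ ∫⁻ x, (E₀.indicator (fun _ => 1) x + ∑ j ∈ Finset.range J,
        (E j).indicator (fun _ => ENNReal.ofReal ((2 * 2 ^ (j + 1)) ^ p)) x) :=
        lintegral_mono hpoint
    _ = volume E₀ + ∑ j ∈ Finset.range J,
        ENNReal.ofReal ((2 * 2 ^ (j + 1)) ^ p) * volume (E j) := by
        rw [lintegral_add_left (measurable_const.indicator hE₀m),
          lintegral_finsetSum _ (fun j _ => measurable_const.indicator (hEm j)),
          lintegral_indicator_const hE₀m, one_mul]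
        congr 1
        exact Finset.sum_congr rfl fun j _ => lintegral_indicator_const (hEm j) _
    _ ≤ ENNReal.ofReal (2 ^ d * δ ^ (d - 1) * N ^ tubeExponent d) +
        ∑ j ∈ Finset.range J,
          ENNReal.ofReal (2 ^ p * (C * K ^ 5 * δ ^ (d - 1) * N ^ tubeExponent d)) := by
        refine add_le_add ?_ (Finset.sum_le_sum fun j _ => ?_)
        · refine (measure_mono hE₀sub).trans (hunion.trans (ENNReal.ofReal_le_ofReal ?_))
          have : 0 ≤ 2 ^ d * δ ^ (d - 1) := by positivity
          nlinarith
        · rw [← ofReal_measureReal (hEfin j), ← ENNReal.ofReal_mul (by positivity)]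
          refine ENNReal.ofReal_le_ofReal ?_
          have h2 : (2 : ℝ) ≤ 2 ^ (j + 1) := le_self_pow₀ (by norm_num) (by omega)
          have := hlev hδ (μ := 2 ^ (j + 1)) h2 hK1 hK a Ω hΩ hdiam hsep (E j) (hEm j)
            (hEfin j) (fun x hx => hx)
          rw [Real.mul_rpow (by norm_num) (by positivity)]
          calc _ = 2 ^ p * (volume.real (E j) * ((2 : ℝ) ^ (j + 1)) ^ p) := by ring
            _ ≤ _ := mul_le_mul_of_nonneg_left this h2p.le
    _ = ENNReal.ofReal (2 ^ d * δ ^ (d - 1) * N ^ tubeExponent d +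
          J * (2 ^ p * (C * K ^ 5 * δ ^ (d - 1) * N ^ tubeExponent d))) := by
        rw [Finset.sum_const, Finset.card_range, nsmul_eq_mul,
          ENNReal.ofReal_add (by positivity) (by positivity),
          ENNReal.ofReal_mul (p := (J : ℝ)) (Nat.cast_nonneg _), ENNReal.ofReal_natCast]
    _ ≤ _ := by
        refine ENNReal.ofReal_le_ofReal ?_
        have hP : 0 ≤ δ ^ (d - 1) * N ^ tubeExponent d := by positivity
        have hK6 : (1 : ℝ) ≤ K ^ 6 := one_le_pow₀ hKR
        have e1 : 2 ^ d * δ ^ (d - 1) * N ^ tubeExponent d ≤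
            2 ^ d * K ^ 6 * δ ^ (d - 1) * N ^ tubeExponent d := by
          have : (2 : ℝ) ^ d ≤ 2 ^ d * K ^ 6 := le_mul_of_one_le_right (by positivity) hK6
          gcongr
        have e2 : J * (2 ^ p * (C * K ^ 5 * δ ^ (d - 1) * N ^ tubeExponent d)) ≤
            (12 * d ^ 2 * K) * (2 ^ p * (C * K ^ 5 * δ ^ (d - 1) * N ^ tubeExponent d)) := by
          gcongr
        refine (add_le_add e1 e2).trans (le_of_eq ?_)
        ring

end Norm

/-! ### The weak-type estimate -/

section WeakType

variable {d : ℕ}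

/-- A set of unit vectors of diameter at most `1 / 4` contains a finite maximal `δ`-separated
subset. -/
lemma exists_separated_net (hd : 0 < d) {δ : ℝ} (hδ : 0 < δ) (hδ1 : δ ≤ 1)
    (S : Set (EuclideanSpace ℝ (Fin d))) (hS : ∀ u ∈ S, ‖u‖ = 1)
    (hdiam : ∀ u ∈ S, ∀ v ∈ S, ‖u - v‖ ≤ 1 / 4) :
    ∃ Ω : Finset (EuclideanSpace ℝ (Fin d)), ↑Ω ⊆ S ∧
      (∀ u ∈ Ω, ∀ v ∈ Ω, u ≠ v → δ ≤ ‖u - v‖) ∧ ∀ u ∈ S, ∃ v ∈ Ω, ‖u - v‖ ≤ δ := by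
  classical
  let P : ℕ → Prop := fun n => ∃ Ω : Finset (EuclideanSpace ℝ (Fin d)), ↑Ω ⊆ S ∧
      (∀ u ∈ Ω, ∀ v ∈ Ω, u ≠ v → δ ≤ ‖u - v‖) ∧ Ω.card = n
  have hbound : ∀ n, P n → n ≤ ⌊(10 * d * 1 / δ) ^ (d - 1)⌋₊ := by
    rintro n ⟨Ω, hΩS, hsep, rfl⟩
    rcases Ω.eq_empty_or_nonempty with h | ⟨u₀, hu₀⟩
    · simp [h]
    refine Nat.le_floor (card_le_pow_of_separated hd hδ hδ1 Ω (hS u₀ (hΩS hu₀))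
      (fun u hu => hS u (hΩS hu)) (fun u hu => hdiam u (hΩS hu) u₀ (hΩS hu₀)) hsep (c := u₀)
      (fun u hu => (hdiam u (hΩS hu) u₀ (hΩS hu₀)).trans (by norm_num)))
  have hP0 : P 0 := ⟨∅, by simp, by simp, rfl⟩
  obtain ⟨Ω, hΩS, hsep, hcard⟩ := Nat.findGreatest_spec (P := P)
    (n := ⌊(10 * d * 1 / δ) ^ (d - 1)⌋₊) (Nat.zero_le _) hP0
  refine ⟨Ω, hΩS, hsep, fun u hu => ?_⟩
  by_contra! hcon
  have huΩ : u ∉ Ω := fun h => by have := hcon u h; simp at this; linarith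
  have hP : P (insert u Ω).card := by
    refine ⟨insert u Ω, ?_, ?_, rfl⟩
    · rw [Finset.coe_insert]; exact Set.insert_subset hu hΩS
    · intro v hv w hw hvw
      rcases Finset.mem_insert.1 hv with rfl | hv' <;>
        rcases Finset.mem_insert.1 hw with rfl | hw'
      · exact absurd rfl hvw
      · exact (hcon w hw').le
      · rw [norm_sub_rev]; exact (hcon v hv').le
      · exact hsep v hv' w hw' hvw
  have h1 := Nat.le_findGreatest (hbound _ hP) hP
  rw [← hcard, Finset.card_insert_of_notMem huΩ] at h1
  omega

lemma toSphere_cap_le (hd : 0 < d) {δ : ℝ} (hδ : 0 ≤ δ) {u : EuclideanSpace ℝ (Fin d)}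
    (hu : ‖u‖ = 1) :
    (volume : Measure (EuclideanSpace ℝ (Fin d))).toSphere
      {ξ | ‖(ξ : EuclideanSpace ℝ (Fin d)) - u‖ ≤ δ} ≤
      ENNReal.ofReal (d * 2 ^ d * δ ^ (d - 1)) := by
  have hmeas : MeasurableSet {ξ : Metric.sphere (0 : EuclideanSpace ℝ (Fin d)) 1 |
      ‖(ξ : EuclideanSpace ℝ (Fin d)) - u‖ ≤ δ} :=
    (isClosed_le (by fun_prop) continuous_const).measurableSet
  rw [Measure.toSphere_apply' _ hmeas, finrank_euclideanSpace_fin, mul_assoc,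
    ENNReal.ofReal_mul (Nat.cast_nonneg _), ENNReal.ofReal_natCast]
  gcongr
  refine (measure_mono (t := solidCylinder 1 δ u 0) ?_).trans
    ((volume_solidCylinder_le hd (by norm_num) hδ hu 0).trans (by rw [mul_one]))
  rintro _ ⟨r, ⟨hr0, hr1⟩, _, ⟨ξ, hξ, rfl⟩, rfl⟩
  have hξ1 : ‖(ξ : EuclideanSpace ℝ (Fin d))‖ = 1 := by simp
  have hu0 := perp_smul_self hu 1
  rw [one_smul] at hu0
  constructor
  · refine (abs_real_inner_le_norm _ _).trans ?_
    simp only [sub_zero, norm_smul, hξ1, hu, mul_one, Real.norm_eq_abs, abs_of_pos hr0]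
    exact hr1.le
  · have h1 : perp u (ξ : EuclideanSpace ℝ (Fin d)) = perp u (ξ - u) := by
      rw [map_sub, hu0, sub_zero]
    simp only [sub_zero, map_smul, norm_smul, Real.norm_eq_abs, abs_of_pos hr0]
    rw [h1]
    have h2 := (norm_perp_le hu ((ξ : EuclideanSpace ℝ (Fin d)) - u)).trans hξ
    nlinarith [norm_nonneg (perp u ((ξ : EuclideanSpace ℝ (Fin d)) - u))]

/-- The arithmetic of exponents that turns the dual estimate into the weak-type one. -/
lemma weak_type_arith (hd : 2 ≤ d) {t α δ N K C c : ℝ} (ht : 0 ≤ t) (hα : 0 ≤ α) (hδ : 0 < δ)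
    (hN : 0 < N) (hK : 1 ≤ K) (hC : 0 < C) (hc : 0 < c)
    (h : t * N * (c * δ ^ (d - 1)) ≤
      α * (C * K ^ 6 * δ ^ (d - 1) * N ^ tubeExponent d) ^ ((d : ℝ) / (d + 2))) :
    N * δ ^ (d - 1) * t ^ (((d : ℝ) - 1) * (d + 2) / d) ≤
      (C ^ ((d : ℝ) / (d + 2)) / c * K ^ 6 * δ ^ (1 - 2 * (d : ℝ) / (d + 2)) * α) ^
        (((d : ℝ) - 1) * (d + 2) / d) := by
  have hd2 : (2 : ℝ) ≤ d := by exact_mod_cast hd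
  set q : ℝ := ((d : ℝ) - 1) * (d + 2) / d with hq
  set r : ℝ := (d : ℝ) / (d + 2) with hr
  have hq0 : 0 < q := by rw [hq]; apply div_pos <;> nlinarith
  have hK0 : 0 < K := by linarith
  have hP : δ ^ (d - 1) = δ ^ ((d : ℝ) - 1) := by
    rw [← Real.rpow_natCast, Nat.cast_sub (by omega)]; simp
  have hKr : (K ^ 6) ^ r ≤ K ^ 6 := by
    conv_rhs => rw [← Real.rpow_one (K ^ 6)]
    refine Real.rpow_le_rpow_of_exponent_le (one_le_pow₀ hK) ?_
    rw [hr, div_le_one (by linarith)]; linarith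
  have h1 : N * δ ^ (d - 1) * t ^ q = (t * (N ^ (1 / q) * δ ^ (((d : ℝ) - 1) / q))) ^ q := by
    rw [Real.mul_rpow ht (by positivity), Real.mul_rpow (by positivity) (by positivity),
      ← Real.rpow_mul hN.le, ← Real.rpow_mul hδ.le, one_div, inv_mul_cancel₀ hq0.ne',
      div_mul_cancel₀ _ hq0.ne', Real.rpow_one, hP]
    ring
  rw [h1]
  refine Real.rpow_le_rpow (by positivity) ?_ hq0.le
  have h2 : (C * K ^ 6 * δ ^ (d - 1) * N ^ tubeExponent d) ^ r =
      C ^ r * (K ^ 6) ^ r * δ ^ (((d : ℝ) - 1) * r) * N ^ (1 - 1 / q) := by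
    rw [Real.mul_rpow (by positivity) (by positivity),
      Real.mul_rpow (by positivity) (by positivity), Real.mul_rpow hC.le (by positivity), hP,
      ← Real.rpow_mul hδ.le, ← Real.rpow_mul hN.le]
    congr 2
    rw [hq, hr, tubeExponent]
    have : (d : ℝ) - 1 ≠ 0 := by linarith
    field_simp
    ring
  rw [h2, hP] at h
  have h3 : N ^ (1 - 1 / q) = N / N ^ (1 / q) := by rw [Real.rpow_sub hN, Real.rpow_one]
  have h4 : δ ^ (1 - 2 * (d : ℝ) / (d + 2)) =
      δ ^ (((d : ℝ) - 1) * r) * δ ^ (((d : ℝ) - 1) / q) / δ ^ ((d : ℝ) - 1) := by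
    rw [← Real.rpow_add hδ, ← Real.rpow_sub hδ]
    congr 1
    rw [hq, hr]
    have : (d : ℝ) - 1 ≠ 0 := by linarith
    field_simp
    ring
  have hδq : 0 < δ ^ (((d : ℝ) - 1) / q) := by positivity
  have hNq : 0 < N ^ (1 / q) := by positivity
  have hδd : 0 < δ ^ ((d : ℝ) - 1) := by positivity
  rw [h3] at h
  rw [h4]
  have h5 : t * (N ^ (1 / q) * δ ^ (((d : ℝ) - 1) / q)) =
      t * N * (c * δ ^ ((d : ℝ) - 1)) *
        (N ^ (1 / q) * δ ^ (((d : ℝ) - 1) / q) / (N * (c * δ ^ ((d : ℝ) - 1)))) := by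
    field_simp
  rw [h5]
  refine (mul_le_mul_of_nonneg_right h (by positivity)).trans ?_
  calc _ = C ^ r / c * (K ^ 6) ^ r *
        (δ ^ (((d : ℝ) - 1) * r) * δ ^ (((d : ℝ) - 1) / q) / δ ^ ((d : ℝ) - 1)) * α := by
        field_simp
    _ ≤ _ := by gcongr

open Classical in
lemma sum_lintegral_kakeyaTube_eq (δ : ℝ)
    (a : EuclideanSpace ℝ (Fin d) → EuclideanSpace ℝ (Fin d))
    (Ω : Finset (EuclideanSpace ℝ (Fin d))) {g : EuclideanSpace ℝ (Fin d) → ℝ≥0∞}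
    (hg : AEMeasurable g) :
    ∑ u ∈ Ω, ∫⁻ x in kakeyaTube δ u (a u), g x = ∫⁻ x, g x * (tubeCount δ a Ω x : ℝ≥0∞) := by
  have h1 : ∀ u ∈ Ω, ∫⁻ x in kakeyaTube δ u (a u), g x =
      ∫⁻ x, (kakeyaTube δ u (a u)).indicator g x := fun u _ =>
    (lintegral_indicator (measurableSet_kakeyaTube _ _ _) _).symm
  rw [Finset.sum_congr rfl h1, ← lintegral_finsetSum' _ fun u _ =>
    hg.indicator (measurableSet_kakeyaTube _ _ _)]
  refine lintegral_congr fun x => ?_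
  rw [tubeCount, Finset.card_filter, Nat.cast_sum, Finset.mul_sum]
  refine Finset.sum_congr rfl fun u _ => ?_
  by_cases h : x ∈ kakeyaTube δ u (a u) <;> simp [h]

/-- The weak-type estimate over a small piece `S` of the superlevel set `{f* > t}`; here `N` is the
number of elements of a `δ`-net of `S`. -/
lemma exists_weak_type_const (hd : 2 ≤ d) : ∃ C : ℝ, 0 < C ∧
    ∀ {δ : ℝ}, 0 < δ → δ ≤ 1 → ∀ {K : ℕ}, 1 ≤ K → 1 ≤ 2 ^ K * δ →
    ∀ f : EuclideanSpace ℝ (Fin d) → ℂ,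
      MemLp f (ENNReal.ofReal (((d : ℝ) + 2) / 2)) volume → ∀ {t : ℝ}, 0 < t →
    ∀ S : Set (Metric.sphere (0 : EuclideanSpace ℝ (Fin d)) 1),
    (∀ ξ ∈ S, ∀ η ∈ S, ‖(ξ : EuclideanSpace ℝ (Fin d)) - η‖ ≤ 1 / 4) →
    (∀ ξ ∈ S, ENNReal.ofReal t < kakeyaMaximal δ f ξ) → S.Nonempty →
    ∃ N : ℕ, 1 ≤ N ∧
      (volume : Measure (EuclideanSpace ℝ (Fin d))).toSphere S ≤
        ENNReal.ofReal (N * (d * 2 ^ d * δ ^ (d - 1))) ∧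
      N * δ ^ (d - 1) * t ^ (((d : ℝ) - 1) * (d + 2) / d) ≤
        (C * K ^ 6 * δ ^ (1 - 2 * (d : ℝ) / (d + 2)) *
          (eLpNorm f (ENNReal.ofReal (((d : ℝ) + 2) / 2)) volume).toReal) ^
          (((d : ℝ) - 1) * (d + 2) / d) := by
  classical
  have hd0 : 0 < d := by omega
  have hdR : (2 : ℝ) ≤ d := by exact_mod_cast hd
  obtain ⟨C, hC, hnorm⟩ := exists_norm_const hd
  set c : ℝ := 2 ^ d * (1 / 2) * (1 / d) ^ (d - 1) with hc
  have hcpos : 0 < c := by positivity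
  refine ⟨C ^ ((d : ℝ) / (d + 2)) / c, by positivity, ?_⟩
  intro δ hδ hδ1 K hK1 hK f hf t ht S hdiam hS hSne
  set A := eLpNorm f (ENNReal.ofReal (((d : ℝ) + 2) / 2)) volume with hA
  have hAtop : A ≠ ∞ := hf.2.ne
  obtain ⟨Ω, hΩS, hsep, hnet⟩ := exists_separated_net hd0 hδ hδ1 (Subtype.val '' S)
    (by rintro _ ⟨ξ, _, rfl⟩; simp)
    (by rintro _ ⟨ξ, hξ, rfl⟩ _ ⟨η, hη, rfl⟩; exact hdiam ξ hξ η hη)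
  have hΩ1 : ∀ u ∈ Ω, ‖u‖ = 1 := by
    intro u hu
    obtain ⟨ξ, _, rfl⟩ := hΩS hu
    simp
  have hex : ∀ u ∈ Ω, ∃ a, ENNReal.ofReal t < (volume (kakeyaTube δ u a))⁻¹ *
      ∫⁻ y in kakeyaTube δ u a, ‖f y‖ₑ := by
    intro u hu
    obtain ⟨ξ, hξ, rfl⟩ := hΩS hu
    exact lt_iSup_iff.1 (hS ξ hξ)
  choose! a ha using hex
  obtain ⟨ξ₀, hξ₀⟩ := hSne
  have hN1 : 1 ≤ Ω.card := by
    obtain ⟨v, hv, _⟩ := hnet ξ₀ ⟨ξ₀, hξ₀, rfl⟩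
    exact Finset.card_pos.2 ⟨v, hv⟩
  refine ⟨Ω.card, hN1, ?_, ?_⟩
  · have hcover : S ⊆ ⋃ u ∈ Ω, {ξ : Metric.sphere (0 : EuclideanSpace ℝ (Fin d)) 1 |
        ‖(ξ : EuclideanSpace ℝ (Fin d)) - u‖ ≤ δ} := by
      intro ξ hξ
      obtain ⟨v, hv, hv'⟩ := hnet ξ ⟨ξ, hξ, rfl⟩
      exact Set.mem_iUnion₂.2 ⟨v, hv, hv'⟩
    refine (measure_mono hcover).trans ((measure_biUnion_finset_le _ _).trans
      ((Finset.sum_le_card_nsmul _ _ _ fun u hu => toSphere_cap_le hd0 hδ.le (hΩ1 u hu)).trans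
        (le_of_eq ?_)))
    rw [nsmul_eq_mul, ENNReal.ofReal_mul (Nat.cast_nonneg _), ENNReal.ofReal_natCast]
  · refine weak_type_arith hd ht.le ENNReal.toReal_nonneg hδ (by exact_mod_cast hN1)
      (by exact_mod_cast hK1) hC hcpos ?_
    set p : ℝ := ((d : ℝ) + 2) / 2 with hp
    set p' : ℝ := ((d : ℝ) + 2) / d with hp'
    have hp1 : 1 < p := by rw [hp]; linarith
    have hp0 : 0 < p := by linarith
    have hconj : p.HolderConjugate p' := by
      rw [Real.holderConjugate_iff]
      refine ⟨hp1, ?_⟩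
      rw [hp, hp']; field_simp; ring
    have hlow : ∀ u ∈ Ω, ENNReal.ofReal (t * (c * δ ^ (d - 1))) ≤
        ∫⁻ y in kakeyaTube δ u (a u), ‖f y‖ₑ := by
      intro u hu
      have hfin := volume_kakeyaTube_ne_top hd0 hδ (hΩ1 u hu) (a u)
      have h1 : ENNReal.ofReal (c * δ ^ (d - 1)) ≤ volume (kakeyaTube δ u (a u)) := by
        have := le_volume_real_kakeyaTube hd0 hδ (hΩ1 u hu) (a u)
        refine le_trans (ENNReal.ofReal_le_ofReal ?_) (ofReal_measureReal hfin).le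
        refine le_trans (le_of_eq ?_) this
        rw [hc, one_div_pow, div_pow]; field_simp
      have hpos : volume (kakeyaTube δ u (a u)) ≠ 0 := by
        have : 0 < ENNReal.ofReal (c * δ ^ (d - 1)) := ENNReal.ofReal_pos.2 (by positivity)
        exact (this.trans_le h1).ne'
      rw [ENNReal.ofReal_mul ht.le]
      calc _ ≤ ((volume (kakeyaTube δ u (a u)))⁻¹ * ∫⁻ y in kakeyaTube δ u (a u), ‖f y‖ₑ) *
            volume (kakeyaTube δ u (a u)) := mul_le_mul' (ha u hu).le h1
        _ = _ := by
            rw [mul_right_comm, ENNReal.inv_mul_cancel hpos hfin, one_mul]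
    have hsum : ENNReal.ofReal (t * Ω.card * (c * δ ^ (d - 1))) ≤
        ∑ u ∈ Ω, ∫⁻ y in kakeyaTube δ u (a u), ‖f y‖ₑ := by
      refine le_trans (le_of_eq ?_) (Finset.card_nsmul_le_sum _ _ _ hlow)
      rw [nsmul_eq_mul, ← ENNReal.ofReal_natCast, ← ENNReal.ofReal_mul (Nat.cast_nonneg _)]
      congr 1; ring
    have hfm : AEMeasurable (fun y => ‖f y‖ₑ) volume := hf.1.enorm
    have hmm : Measurable fun x => (tubeCount δ a Ω x : ℝ≥0∞) := by
      have := (measurable_tubeCount δ a Ω).ennreal_ofReal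
      simpa only [ENNReal.ofReal_natCast] using this
    have hAeq : A = (∫⁻ y, ‖f y‖ₑ ^ p) ^ (1 / p) := by
      rw [hA, eLpNorm_eq_lintegral_rpow_enorm_toReal
        (by simpa using hp0) ENNReal.ofReal_ne_top, ENNReal.toReal_ofReal hp0.le]
    rw [sum_lintegral_kakeyaTube_eq δ a Ω hfm] at hsum
    have hH := hsum.trans (ENNReal.lintegral_mul_le_Lp_mul_Lq volume hconj hfm hmm.aemeasurable)
    have hn := hnorm hδ hδ1 hK1 hK a Ω hΩ1
      (fun u hu v hv => by
        obtain ⟨ξ, hξ, rfl⟩ := hΩS hu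
        obtain ⟨η, hη, rfl⟩ := hΩS hv
        exact hdiam ξ hξ η hη) hsep
    rw [← hAeq] at hH
    have hp'0 : 0 < p' := hconj.symm.pos
    have h2 := hH.trans (mul_le_mul_right (ENNReal.rpow_le_rpow hn (by positivity :
      0 ≤ 1 / p')) A)
    rw [← ENNReal.ofReal_toReal hAtop, ENNReal.ofReal_rpow_of_nonneg (by positivity)
      (by positivity), ← ENNReal.ofReal_mul ENNReal.toReal_nonneg,
      ENNReal.ofReal_le_ofReal_iff (by positivity)] at h2
    have h3 : 1 / p' = (d : ℝ) / (d + 2) := by rw [hp', one_div_div]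
    rwa [h3] at h2

end WeakType

/-! ### Measurability of the maximal function -/

section Measurability

variable {d : ℕ}

lemma convex_norm_map_sub_le {F : Type*} [NormedAddCommGroup F] [NormedSpace ℝ F]
    (L : EuclideanSpace ℝ (Fin d) →L[ℝ] F) (z : EuclideanSpace ℝ (Fin d)) (r : ℝ) :
    Convex ℝ {y | ‖L (y - z)‖ ≤ r} := by
  intro x hx y hy α β hα hβ hαβ
  have h : α • x + β • y - z = α • (x - z) + β • (y - z) := by
    have : z = (α + β) • z := by rw [hαβ, one_smul]
    conv_lhs => rw [this, add_smul]
    rw [smul_sub, smul_sub]; abel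
  simp only [Set.mem_ofPred_eq] at hx hy ⊢
  rw [h, map_add, map_smul, map_smul]
  refine (norm_add_le _ _).trans ?_
  rw [norm_smul, norm_smul, Real.norm_of_nonneg hα, Real.norm_of_nonneg hβ]
  calc _ ≤ α * r + β * r := by gcongr
    _ = r := by rw [← add_mul, hαβ, one_mul]

lemma convex_kakeyaTube (δ : ℝ) (ω a : EuclideanSpace ℝ (Fin d)) :
    Convex ℝ (kakeyaTube δ ω a) := by
  rw [kakeyaTube_eq_solidCylinder]
  have : solidCylinder (1 / 2) δ ω a =
      {y | ‖innerSL ℝ ω (y - a)‖ ≤ 1 / 2} ∩ {y | ‖perp ω (y - a)‖ ≤ δ} := by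
    ext y
    simp [solidCylinder, real_inner_comm]
  rw [this]
  exact (convex_norm_map_sub_le _ _ _).inter (convex_norm_map_sub_le _ _ _)

/-- An interior point of a tube satisfies the defining inequalities strictly, since it can be moved
slightly away from the centre. -/
lemma lt_of_mem_interior_kakeyaTube {δ : ℝ} (hδ : 0 < δ) {ω a y : EuclideanSpace ℝ (Fin d)}
    (hy : y ∈ interior (kakeyaTube δ ω a)) :
    |inner ℝ (y - a) ω| < 1 / 2 ∧ ‖perp ω (y - a)‖ < δ := by
  have hcont : Filter.Tendsto (fun t : ℝ => a + (1 + t) • (y - a)) (nhds 0) (nhds y) := by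
    have : Continuous fun t : ℝ => a + (1 + t) • (y - a) := by fun_prop
    simpa using this.tendsto 0
  have hev := hcont.eventually (mem_interior_iff_mem_nhds.1 hy)
  have hev' : ∀ᶠ t in nhdsWithin (0 : ℝ) (Set.Ioi 0), a + (1 + t) • (y - a) ∈ kakeyaTube δ ω a :=
    nhdsWithin_le_nhds hev
  obtain ⟨t, ht, ht0⟩ := (hev'.and self_mem_nhdsWithin).exists
  have ht0' : 0 < t := ht0
  rw [kakeyaTube_eq_solidCylinder] at ht
  obtain ⟨h1, h2⟩ := ht
  rw [add_sub_cancel_left, inner_smul_left] at h1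
  rw [add_sub_cancel_left, map_smul, norm_smul, Real.norm_of_nonneg (by linarith)] at h2
  simp only [conj_trivial] at h1
  rw [abs_mul, abs_of_pos (by linarith : 0 < 1 + t)] at h1
  constructor
  · by_contra! h
    nlinarith
  · by_contra! h
    nlinarith

lemma kakeyaTube_eq_preimage (i₀ : Fin d) (δ : ℝ) {ω : EuclideanSpace ℝ (Fin d)}
    (a : EuclideanSpace ℝ (Fin d))
    (b : OrthonormalBasis (Fin d) ℝ (EuclideanSpace ℝ (Fin d))) (hb : b i₀ = ω) :
    kakeyaTube δ ω a = (fun y => b.repr y - b.repr a) ⁻¹'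
      kakeyaTube δ (EuclideanSpace.single i₀ 1) 0 := by
  have hω : b.repr ω = EuclideanSpace.single i₀ 1 := by rw [← hb, b.repr_self]
  ext y
  have h1 : inner ℝ (y - a) ω = inner ℝ (b.repr y - b.repr a) (EuclideanSpace.single i₀ 1) := by
    rw [← hω, ← map_sub, b.repr.inner_map_map]
  have h2 : b.repr y - b.repr a - inner ℝ (y - a) ω • EuclideanSpace.single i₀ (1 : ℝ) =
      b.repr ((y - a) - inner ℝ (y - a) ω • ω) := by
    rw [← hω, map_sub, map_sub, map_smul]
  simp only [kakeyaTube, Set.mem_ofPred_eq, Set.mem_preimage, sub_zero]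
  rw [← h1, h2, b.repr.norm_map]

lemma volume_kakeyaTube_eq (i₀ : Fin d) (δ : ℝ) {ω : EuclideanSpace ℝ (Fin d)} (hω : ‖ω‖ = 1)
    (a : EuclideanSpace ℝ (Fin d)) :
    volume (kakeyaTube δ ω a) = volume (kakeyaTube δ (EuclideanSpace.single i₀ (1 : ℝ)) 0) := by
  obtain ⟨b, hb⟩ := exists_orthonormalBasis_apply_eq i₀ hω
  rw [kakeyaTube_eq_preimage i₀ δ a b hb]
  exact ((measurePreserving_sub_right volume (b.repr a)).comp
    b.measurePreserving_repr).measure_preimage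
      (measurableSet_kakeyaTube _ _ _).nullMeasurableSet

lemma lowerSemicontinuous_setLIntegral_kakeyaTube {δ : ℝ} (hδ : 0 < δ)
    (a : EuclideanSpace ℝ (Fin d)) {g : EuclideanSpace ℝ (Fin d) → ℝ≥0∞} (hg : AEMeasurable g) :
    LowerSemicontinuous fun ξ : EuclideanSpace ℝ (Fin d) => ∫⁻ y in kakeyaTube δ ξ a, g y := by
  rw [lowerSemicontinuous_iff_le_liminf]
  intro ξ
  have h1 : ∫⁻ y in kakeyaTube δ ξ a, g y = ∫⁻ y in interior (kakeyaTube δ ξ a), g y :=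
    setLIntegral_congr (interior_ae_eq_of_null_frontier
      ((convex_kakeyaTube δ ξ a).addHaar_frontier volume)).symm
  rw [h1, ← lintegral_indicator isOpen_interior.measurableSet]
  calc _ ≤ ∫⁻ y, Filter.liminf (fun ξ' => (kakeyaTube δ ξ' a).indicator g y) (nhds ξ) := by
        refine lintegral_mono fun y => ?_
        by_cases hy : y ∈ interior (kakeyaTube δ ξ a)
        · rw [Set.indicator_of_mem hy]
          obtain ⟨h2, h3⟩ := lt_of_mem_interior_kakeyaTube hδ hy
          rw [perp_apply] at h3
          refine Filter.le_liminf_of_le (by isBoundedDefault) ?_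
          have e1 : ∀ᶠ ξ' in nhds ξ, |inner ℝ (y - a) ξ'| < 1 / 2 :=
            (Continuous.tendsto (by fun_prop : Continuous fun ξ' => |inner ℝ (y - a) ξ'|)
              ξ).eventually (gt_mem_nhds h2)
          have e2 : ∀ᶠ ξ' in nhds ξ, ‖(y - a) - inner ℝ (y - a) ξ' • ξ'‖ < δ :=
            (Continuous.tendsto (by fun_prop : Continuous fun ξ' : EuclideanSpace ℝ (Fin d) =>
              ‖(y - a) - inner ℝ (y - a) ξ' • ξ'‖) ξ).eventually (gt_mem_nhds h3)
          filter_upwards [e1, e2] with ξ' h4 h5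
          rw [Set.indicator_of_mem (show y ∈ kakeyaTube δ ξ' a from ⟨h4.le, h5.le⟩)]
        · rw [Set.indicator_of_notMem hy]; exact zero_le
    _ ≤ Filter.liminf (fun ξ' => ∫⁻ y, (kakeyaTube δ ξ' a).indicator g y) (nhds ξ) :=
        lintegral_liminf_le' fun ξ' => hg.indicator (measurableSet_kakeyaTube _ _ _)
    _ = _ := by
        congr 1
        funext ξ'
        exact lintegral_indicator (measurableSet_kakeyaTube _ _ _) _

/-- The maximal function is a supremum of lower semicontinuous functions, because the volume of a
tube does not depend on its direction. -/
lemma measurable_kakeyaMaximal (hd : 0 < d) {δ : ℝ} (hδ : 0 < δ)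
    {f : EuclideanSpace ℝ (Fin d) → ℂ} (hf : AEStronglyMeasurable f volume) :
    Measurable (kakeyaMaximal δ f) := by
  set V := volume (kakeyaTube δ (EuclideanSpace.single (⟨0, hd⟩ : Fin d) (1 : ℝ)) 0) with hV
  have heq : kakeyaMaximal δ f = fun ξ : Metric.sphere (0 : EuclideanSpace ℝ (Fin d)) 1 => V⁻¹ *
      ⨆ a, ∫⁻ y in kakeyaTube δ (ξ : EuclideanSpace ℝ (Fin d)) a, ‖f y‖ₑ := by
    funext ξ
    rw [kakeyaMaximal, ENNReal.mul_iSup]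
    refine iSup_congr fun a => ?_
    rw [volume_kakeyaTube_eq ⟨0, hd⟩ δ (by simp) a]
  rw [heq]
  refine Measurable.const_mul ?_ _
  have hlsc : LowerSemicontinuous fun ξ : EuclideanSpace ℝ (Fin d) =>
      ⨆ a, ∫⁻ y in kakeyaTube δ ξ a, ‖f y‖ₑ :=
    lowerSemicontinuous_iSup fun a => lowerSemicontinuous_setLIntegral_kakeyaTube hδ a hf.enorm
  exact hlsc.measurable.comp measurable_subtype_coe

end Measurability

/-! ### The strong-type estimate -/

section StrongType

variable {d : ℕ}

/-- A function taking values up to `2 ^ K * G` is controlled by its dyadic superlevel sets. -/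
lemma rpow_le_add_sum_indicator {α : Type*} {F : α → ℝ≥0∞} {G q : ℝ} {K : ℕ} (hG : 0 < G)
    (hq : 0 ≤ q) (hF : ∀ x, F x ≤ ENNReal.ofReal (2 ^ K * G)) (x : α) :
    F x ^ q ≤ ENNReal.ofReal (G ^ q) + ∑ j ∈ Finset.range K,
      {y | ENNReal.ofReal (2 ^ j * G) < F y}.indicator
        (fun _ => ENNReal.ofReal (2 ^ q) * ENNReal.ofReal ((2 ^ j * G) ^ q)) x := by
  classical
  have hex : ∃ n : ℕ, F x ≤ ENNReal.ofReal (2 ^ n * G) := ⟨K, hF x⟩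
  have h1 := Nat.find_spec hex
  have h2 : Nat.find hex ≤ K := Nat.find_min' hex (hF x)
  rcases Nat.eq_zero_or_pos (Nat.find hex) with h0 | hpos
  · rw [h0, pow_zero, one_mul] at h1
    refine le_add_right ?_
    rw [← ENNReal.ofReal_rpow_of_nonneg hG.le hq]
    exact ENNReal.rpow_le_rpow h1 hq
  · obtain ⟨j, hj⟩ : ∃ j, Nat.find hex = j + 1 := ⟨_, (Nat.sub_add_cancel hpos).symm⟩
    have h3 : ENNReal.ofReal (2 ^ j * G) < F x := not_le.1 (Nat.find_min hex (by omega))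
    rw [hj] at h1 h2
    refine le_trans ?_ (le_add_left (Finset.single_le_sum (fun _ _ => zero_le)
      (Finset.mem_range.2 h2)))
    rw [Set.indicator_of_mem (show x ∈ {y | ENNReal.ofReal (2 ^ j * G) < F y} from h3),
      ← ENNReal.ofReal_mul (by positivity), ← Real.mul_rpow (by norm_num) (by positivity),
      ← ENNReal.ofReal_rpow_of_nonneg (by positivity) hq]
    refine ENNReal.rpow_le_rpow (h1.trans (le_of_eq ?_)) hq
    congr 1; ring

/-- The strong-type estimate with a power of the number `K` of dyadic scales in place of
`δ ^ (-ε)`. -/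
lemma exists_strong_type_const (hd : 2 ≤ d) : ∃ C : ℝ, 0 < C ∧
    ∀ {δ : ℝ}, 0 < δ → δ ≤ 1 → ∀ {K : ℕ}, 1 ≤ K → 1 ≤ 2 ^ K * δ →
    ∀ f : EuclideanSpace ℝ (Fin d) → ℂ,
      MemLp f (ENNReal.ofReal (((d : ℝ) + 2) / 2)) volume →
      eLpNorm (kakeyaMaximal δ f)
          (ENNReal.ofReal (((d : ℝ) - 1) * ((d : ℝ) + 2) / (d : ℝ)))
          (volume : Measure (EuclideanSpace ℝ (Fin d))).toSphere ≤
        ENNReal.ofReal (C * K ^ 7 * δ ^ (1 - 2 * (d : ℝ) / ((d : ℝ) + 2))) *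
          eLpNorm f (ENNReal.ofReal (((d : ℝ) + 2) / 2)) volume := by
  have hd0 : 0 < d := by omega
  have hdR : (2 : ℝ) ≤ d := by exact_mod_cast hd
  obtain ⟨C, hC, hweak⟩ := exists_weak_type_const hd
  set σ := (volume : Measure (EuclideanSpace ℝ (Fin d))).toSphere with hσ
  obtain ⟨F, -, hFfin, hFcover⟩ := finite_cover_balls_of_compact
    (isCompact_univ : IsCompact (Set.univ : Set (Metric.sphere (0 : EuclideanSpace ℝ (Fin d)) 1)))
    (show (0 : ℝ) < 1 / 8 by norm_num)
  set q : ℝ := ((d : ℝ) - 1) * ((d : ℝ) + 2) / (d : ℝ) with hq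
  have hqd : ((d - 1 : ℕ) : ℝ) ≤ q := by
    rw [hq, le_div_iff₀ (by linarith), Nat.cast_sub (by omega)]
    push_cast
    nlinarith
  have hq1 : 1 ≤ q := by
    refine le_trans ?_ hqd
    exact_mod_cast (by omega : 1 ≤ d - 1)
  have hq0 : 0 < q := by linarith
  set M : ℕ := hFfin.toFinset.card with hM
  set W : ℝ := 1 + σ.real Set.univ + 2 * (2 ^ q * (M * (d * 2 ^ d))) with hW
  have hσ0 : 0 ≤ σ.real Set.univ := measureReal_nonneg
  have hW1 : 1 ≤ W := by
    have : 0 ≤ 2 * ((2 : ℝ) ^ q * (M * (d * 2 ^ d))) := by positivity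
    linarith
  refine ⟨C * W, by positivity, ?_⟩
  intro δ hδ hδ1 K hK1 hK f hf
  have hKR : (1 : ℝ) ≤ K := by exact_mod_cast hK1
  set A := eLpNorm f (ENNReal.ofReal (((d : ℝ) + 2) / 2)) volume with hA
  have hAtop : A ≠ ∞ := hf.2.ne
  rcases (ENNReal.toReal_nonneg (a := A)).eq_or_lt with h0 | hApos
  · have hA0 : A = 0 := ((ENNReal.toReal_eq_zero_iff A).1 h0.symm).resolve_right hAtop
    have hp0 : ENNReal.ofReal (((d : ℝ) + 2) / 2) ≠ 0 := by
      rw [Ne, ENNReal.ofReal_eq_zero, not_le]; positivity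
    have hf0 := (eLpNorm_eq_zero_iff hf.1 hp0).1 hA0
    have hzero : kakeyaMaximal δ f = 0 := by
      funext ξ
      refine (iSup_congr fun a => ?_).trans iSup_const
      have : ∫⁻ y in kakeyaTube δ (ξ : EuclideanSpace ℝ (Fin d)) a, ‖f y‖ₑ = 0 := by
        rw [lintegral_congr_ae (g := fun _ => 0)]
        · simp
        · filter_upwards [ae_restrict_of_ae hf0] with y hy
          simp [hy]
      rw [this, mul_zero]
      rfl
    rw [hzero]
    simp
  set G : ℝ := C * K ^ 6 * δ ^ (1 - 2 * (d : ℝ) / ((d : ℝ) + 2)) * A.toReal with hG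
  have hGpos : 0 < G := by positivity
  -- a single direction is a net with one element, which bounds the maximal function pointwise
  have hmax : ∀ ξ, kakeyaMaximal δ f ξ ≤ ENNReal.ofReal (2 ^ (K + 1) * G) := by
    intro ξ
    by_contra! hlt
    obtain ⟨N, hN1, -, hN⟩ := hweak hδ hδ1 hK1 hK f hf (t := 2 ^ (K + 1) * G) (by positivity) {ξ}
      (by rintro _ rfl _ rfl; simp) (by rintro _ rfl; exact hlt) (Set.singleton_nonempty ξ)
    change N * δ ^ (d - 1) * (2 ^ (K + 1) * G) ^ q ≤ G ^ q at hN
    rw [Real.mul_rpow (by positivity) hGpos.le] at hN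
    have hGq : 0 < G ^ q := by positivity
    have h1 : (2 : ℝ) ^ (d - 1) ≤ δ ^ (d - 1) * ((2 : ℝ) ^ (K + 1)) ^ q := by
      calc (2 : ℝ) ^ (d - 1) ≤ (δ * 2 ^ (K + 1)) ^ (d - 1) := by
            refine pow_le_pow_left₀ (by norm_num) ?_ _
            rw [pow_succ]; linarith
        _ = δ ^ (d - 1) * ((2 : ℝ) ^ (K + 1)) ^ ((d - 1 : ℕ) : ℝ) := by
            rw [Real.rpow_natCast, mul_pow]
        _ ≤ _ := by
            gcongr
            exact one_le_pow₀ (by norm_num)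
    have h2 : (2 : ℝ) ≤ 2 ^ (d - 1) := le_self_pow₀ (by norm_num) (by omega)
    have h3 : (1 : ℝ) ≤ N := by exact_mod_cast hN1
    have h4 : (2 : ℝ) ≤ N * (δ ^ (d - 1) * ((2 : ℝ) ^ (K + 1)) ^ q) := by nlinarith
    nlinarith
  have hmeas := measurable_kakeyaMaximal hd0 hδ hf.1
  set S : ℕ → Set (Metric.sphere (0 : EuclideanSpace ℝ (Fin d)) 1) := fun j =>
    {ξ | ENNReal.ofReal (2 ^ j * G) < kakeyaMaximal δ f ξ} with hS
  have hSm : ∀ j, MeasurableSet (S j) := fun j => measurableSet_lt measurable_const hmeas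
  have hSσ : ∀ j, ENNReal.ofReal ((2 ^ j * G) ^ q) * σ (S j) ≤
      ENNReal.ofReal (M * (d * 2 ^ d * G ^ q)) := by
    intro j
    have hcover : S j ⊆ ⋃ c ∈ hFfin.toFinset, S j ∩ Metric.ball c (1 / 8) := by
      intro ξ hξ
      obtain ⟨c, hc, hξc⟩ := Set.mem_iUnion₂.1 (hFcover (Set.mem_univ ξ))
      exact Set.mem_iUnion₂.2 ⟨c, hFfin.mem_toFinset.2 hc, hξ, hξc⟩
    have hpiece : ∀ c ∈ hFfin.toFinset, ENNReal.ofReal ((2 ^ j * G) ^ q) *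
        σ (S j ∩ Metric.ball c (1 / 8)) ≤ ENNReal.ofReal (d * 2 ^ d * G ^ q) := by
      intro c _
      rcases (S j ∩ Metric.ball c (1 / 8)).eq_empty_or_nonempty with he | hne
      · rw [he, measure_empty, mul_zero]; exact zero_le
      obtain ⟨N, -, hN, hN'⟩ := hweak hδ hδ1 hK1 hK f hf (t := 2 ^ j * G) (by positivity)
        (S j ∩ Metric.ball c (1 / 8)) (fun ξ hξ η hη => by
          have h1 := dist_triangle_right ξ η c
          have h2 := Metric.mem_ball.1 hξ.2
          have h3 := Metric.mem_ball.1 hη.2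
          rw [Subtype.dist_eq, dist_eq_norm] at h1
          linarith) (fun ξ hξ => hξ.1) hne
      refine (mul_le_mul_right hN _).trans ?_
      rw [← ENNReal.ofReal_mul (by positivity)]
      refine ENNReal.ofReal_le_ofReal ?_
      calc _ = d * 2 ^ d * (N * δ ^ (d - 1) * (2 ^ j * G) ^ q) := by ring
        _ ≤ _ := mul_le_mul_of_nonneg_left hN' (by positivity)
    calc _ ≤ ENNReal.ofReal ((2 ^ j * G) ^ q) *
          ∑ c ∈ hFfin.toFinset, σ (S j ∩ Metric.ball c (1 / 8)) :=
          mul_le_mul_right ((measure_mono hcover).trans (measure_biUnion_finset_le _ _)) _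
      _ ≤ ∑ c ∈ hFfin.toFinset, ENNReal.ofReal (d * 2 ^ d * G ^ q) := by
          rw [Finset.mul_sum]; exact Finset.sum_le_sum hpiece
      _ = _ := by
          rw [Finset.sum_const, nsmul_eq_mul, ENNReal.ofReal_mul (Nat.cast_nonneg _),
            ENNReal.ofReal_natCast]
  have hint : ∫⁻ ξ, kakeyaMaximal δ f ξ ^ q ∂σ ≤ ENNReal.ofReal ((G * (K * W)) ^ q) := by
    calc _ ≤ ∫⁻ ξ, (ENNReal.ofReal (G ^ q) + ∑ j ∈ Finset.range (K + 1), (S j).indicator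
          (fun _ => ENNReal.ofReal (2 ^ q) * ENNReal.ofReal ((2 ^ j * G) ^ q)) ξ) ∂σ :=
          lintegral_mono fun ξ => rpow_le_add_sum_indicator hGpos hq0.le hmax ξ
      _ = ENNReal.ofReal (G ^ q) * σ Set.univ + ∑ j ∈ Finset.range (K + 1),
          ENNReal.ofReal (2 ^ q) * (ENNReal.ofReal ((2 ^ j * G) ^ q) * σ (S j)) := by
          rw [lintegral_add_left measurable_const, lintegral_const,
            lintegral_finsetSum _ fun j _ => measurable_const.indicator (hSm j)]
          congr 1
          refine Finset.sum_congr rfl fun j _ => ?_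
          rw [lintegral_indicator_const (hSm j), mul_assoc]
      _ ≤ ENNReal.ofReal (G ^ q) * σ Set.univ + ∑ j ∈ Finset.range (K + 1),
          ENNReal.ofReal (2 ^ q) * ENNReal.ofReal (M * (d * 2 ^ d * G ^ q)) := by
          gcongr
          exact hSσ _
      _ = ENNReal.ofReal (G ^ q * σ.real Set.univ +
          ((K + 1 : ℕ) : ℝ) * (2 ^ q * (M * (d * 2 ^ d * G ^ q)))) := by
          rw [Finset.sum_const, Finset.card_range, nsmul_eq_mul,
            ENNReal.ofReal_add (by positivity) (by positivity),
            ENNReal.ofReal_mul (p := G ^ q) (by positivity), ofReal_measureReal,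
            ENNReal.ofReal_mul (p := ((K + 1 : ℕ) : ℝ)) (Nat.cast_nonneg _),
            ENNReal.ofReal_natCast, ENNReal.ofReal_mul (p := 2 ^ q) (by positivity)]
      _ ≤ _ := by
          refine ENNReal.ofReal_le_ofReal ?_
          rw [Real.mul_rpow hGpos.le (by positivity)]
          have hKW : K * W ≤ (K * W) ^ q :=
            Real.self_le_rpow_of_one_le (one_le_mul_of_one_le_of_one_le hKR hW1) hq1
          have hB : 0 ≤ (2 : ℝ) ^ q * (M * (d * 2 ^ d)) := by positivity
          have h1 : σ.real Set.univ + ((K + 1 : ℕ) : ℝ) * ((2 : ℝ) ^ q * (M * (d * 2 ^ d))) ≤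
              K * W := by
            rw [hW]; push_cast
            nlinarith
          calc _ = G ^ q * (σ.real Set.univ +
                ((K + 1 : ℕ) : ℝ) * ((2 : ℝ) ^ q * (M * (d * 2 ^ d)))) := by ring
            _ ≤ _ := mul_le_mul_of_nonneg_left (h1.trans hKW) (by positivity)
  rw [eLpNorm_eq_lintegral_rpow_enorm_toReal (by simpa using hq0) ENNReal.ofReal_ne_top,
    ENNReal.toReal_ofReal hq0.le]
  simp only [enorm_eq_self]
  refine (ENNReal.rpow_le_rpow hint (by positivity)).trans (le_of_eq ?_)
  rw [ENNReal.ofReal_rpow_of_nonneg (by positivity) (by positivity), one_div,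
    Real.rpow_rpow_inv (by positivity) hq0.ne', ← ENNReal.ofReal_toReal hAtop,
    ← ENNReal.ofReal_mul (by positivity), hG]
  congr 1
  ring

/-- The number of dyadic scales between `δ` and `1` is bounded by a small power of `1 / δ`. -/
lemma exists_scale_count_const {η : ℝ} (hη : 0 < η) : ∃ B : ℝ, 0 < B ∧ ∀ {δ : ℝ}, 0 < δ → δ ≤ 1 →
    ∃ K : ℕ, 1 ≤ K ∧ 1 ≤ 2 ^ K * δ ∧ (K : ℝ) ≤ B * δ ^ (-η) := by
  have hlog : 0 < Real.log 2 := Real.log_pos (by norm_num)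
  refine ⟨2 + 1 / (η * Real.log 2), by positivity, ?_⟩
  intro δ hδ hδ1
  have hinv : 1 ≤ δ⁻¹ := (one_le_inv₀ hδ).2 hδ1
  have hlogδ : 0 ≤ Real.log δ⁻¹ := Real.log_nonneg hinv
  have hle : (⌈Real.log δ⁻¹ / Real.log 2⌉₊ : ℝ) ≤ Real.log δ⁻¹ / Real.log 2 + 1 :=
    (Nat.ceil_lt_add_one (by positivity)).le
  refine ⟨⌈Real.log δ⁻¹ / Real.log 2⌉₊ + 1, by omega, ?_, ?_⟩
  · have h1 : Real.log δ⁻¹ ≤ ((⌈Real.log δ⁻¹ / Real.log 2⌉₊ + 1 : ℕ) : ℝ) * Real.log 2 := by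
      rw [← div_le_iff₀ hlog]
      push_cast
      linarith [Nat.le_ceil (Real.log δ⁻¹ / Real.log 2)]
    rw [← Real.log_pow, Real.log_le_log_iff (by positivity) (by positivity)] at h1
    rwa [inv_le_iff_one_le_mul₀ hδ] at h1
  · have h2 : Real.log δ⁻¹ ≤ δ ^ (-η) / η := by
      rw [Real.rpow_neg hδ.le, ← Real.inv_rpow hδ.le]
      exact Real.log_le_rpow_div (by positivity) hη
    have h3 : 1 ≤ δ ^ (-η) := Real.one_le_rpow_of_pos_of_le_one_of_nonpos hδ hδ1 (by linarith)
    have h4 : Real.log δ⁻¹ / Real.log 2 ≤ δ ^ (-η) / η / Real.log 2 := by gcongr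
    push_cast
    calc _ ≤ δ ^ (-η) / η / Real.log 2 + 2 * δ ^ (-η) := by linarith
      _ = _ := by field_simp; ring

end StrongType

theorem theorem1p1 (d : ℕ) (hd : 3 ≤ d) (ε : ℝ) (hε : 0 < ε) :
    ∃ C : ℝ, 0 < C ∧ ∀ δ : ℝ, 0 < δ → δ ≤ 1 →
      ∀ f : EuclideanSpace ℝ (Fin d) → ℂ,
        MemLp f (ENNReal.ofReal (((d : ℝ) + 2) / 2)) volume →
          Measurable (kakeyaMaximal δ f) ∧
          eLpNorm (kakeyaMaximal δ f)
              (ENNReal.ofReal (((d : ℝ) - 1) * ((d : ℝ) + 2) / (d : ℝ)))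
              (volume : Measure (EuclideanSpace ℝ (Fin d))).toSphere ≤
            ENNReal.ofReal (C * δ ^ (1 - 2 * (d : ℝ) / ((d : ℝ) + 2) - ε)) *
              eLpNorm f (ENNReal.ofReal (((d : ℝ) + 2) / 2)) volume := by
  obtain ⟨C, hC, hstrong⟩ := exists_strong_type_const (d := d) (by omega)
  obtain ⟨B, hB, hscale⟩ := exists_scale_count_const (η := ε / 7) (by positivity)
  refine ⟨C * B ^ 7, by positivity, fun δ hδ hδ1 f hf =>
    ⟨measurable_kakeyaMaximal (by omega) hδ hf.1, ?_⟩⟩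
  obtain ⟨K, hK1, hK, hKle⟩ := hscale hδ hδ1
  refine (hstrong hδ hδ1 hK1 hK f hf).trans ?_
  gcongr ENNReal.ofReal ?_ * _
  have h1 : (K : ℝ) ^ 7 ≤ B ^ 7 * δ ^ (-ε) := by
    calc (K : ℝ) ^ 7 ≤ (B * δ ^ (-(ε / 7))) ^ 7 := by gcongr
      _ = B ^ 7 * δ ^ (-ε) := by
          rw [mul_pow, ← Real.rpow_natCast (δ ^ _), ← Real.rpow_mul hδ.le]
          congr 2
          push_cast; ring
  rw [sub_eq_add_neg _ ε, Real.rpow_add hδ]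
  calc _ ≤ C * (B ^ 7 * δ ^ (-ε)) * δ ^ (1 - 2 * (d : ℝ) / ((d : ℝ) + 2)) := by gcongr
    _ = _ := by ring
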